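/- Let $R$ be a commutative noetherian domain; all modules are finitely generated. An $R$-module $M$ is maximal Cohen--Macaulay (MCM) if $\operatorname{depth} M_{\mathfrak p}\ge \operatorname{ht}\mathfrak p$ for all primes $\mathfrak p$ of $R$ (with $\operatorname{depth}0=\infty$), and pseudo-zero if $M_{\mathfrak p}=0$ for all primes $\mathfrak p$ with $\operatorname{ht}\mathfrak p\le 1$. Let $\mathsf H(R)$ be the quotient of the Grothendieck group of finitely generated $R$-modules by the subgroup generated by the classes of pseudo-zero modules, and put $\mathsf H(R)_{\mathbb R}=\mathsf H(R)\otimes_{\mathbb Z}\mathbb R$. Let $\mathsf K(R)$ be the kernel of the rank function $\operatorname{rk}:\mathsf H(R)\to\mathbb Z$, let $\mathsf K(R)_{\mathbb R}\subseteq\mathsf H(R)_{\mathbb R}$ be its real extension, and let $\operatorname{rk}_{\mathbb R}:\mathsf H(R)_{\mathbb R}\to\mathbb R$ be the extended rank function. Assume $\dim_{\mathbb R}\mathsf H(R)_{\mathbb R}<\infty$ and give $\mathsf H(R)_{\mathbb R}$ the Euclidean metric for which some fixed basis is orthonormal (the notions below do not depend on the basis). Let $r$ be a positive integer. Let $\mathsf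 C_r(R)=\sum_{M}\mathbb R_{\ge0}[M]\subseteq\mathsf H(R)_{\mathbb R}$, where $M$ runs over the MCM $R$-modules of rank $r$, and let $\mathsf C_r^0(R)=\{x\in\mathsf C_r(R)\mid\operatorname{rk}_{\mathbb R}(x)=r\}$. A rank $r$ MCM point is an element of $\mathsf H(R)_{\mathbb R}$ of the form $[M]$ with $M$ an MCM $R$-module of rank $r$. A convex cone is polyhedral if it is spanned by finitely many vectors, and a convex cone $C$ is strongly convex if $C\cap(-C)=\{0\}$. Consider the following conditions. - (a) There are only finitely many nonisomorphic MCM $R$-modules of rank $r$. - (b) There are only finitely many rank $r$ MCM points in $\mathsf C_r(R)$. - (c) The convex cone $\mathsf C_r(R)$ is polyhedral. - (d) The subset $\mathsf C_r(R)$ of $\mathsf H(R)_{\mathbb R}$ is closed. - (e) $\overline{\mathsf C_r(R)}\cap\mathsf K(R)_{\mathbb R}=\{0\}$. - (f) The subset $\mathsf C_r^0(R)$ of $\mathsf H(R)_{\mathbb R}$ is bounded. - (g) The convex cone $\overline{\mathsf C_r(R)}$ is strongly convex. Then the implications (a) $\Rightarrow$ (b) $\Rightarrow$ (c) $\Rightarrow$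 (d) $\Rightarrow$ (e) $\Leftrightarrow$ (f) $\Rightarrow$ (g) hold. If $\mathsf H(R)$ is a finitely generated abelian group, then (b)--(f) are equivalent. If $R$ is normal, $\mathsf H(R)$ is finitely generated and $r=1$, then (a)--(f) are equivalent. If $R$ is a normal Cohen--Macaulay ring with a canonical module (a module $\omega$ such that $\omega_{\mathfrak p}$ is a canonical module of the local ring $R_{\mathfrak p}$ for every prime $\mathfrak p$), then (e) and (g) are equivalent. -/

import Mathlib

/-! Grothendieck groups modulo pseudo-zero modules and the cones spanned by maximal
Cohen-Macaulay modules, for a commutative (noetherian) ring. All modules are finitely generated. -/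

universe u

noncomputable section

open CategoryTheory TensorProduct

namespace CMCone

/-! ### Depth and maximal Cohen-Macaulay modules -/

section LocalDepth

variable (A : Type u) [CommRing A] [IsLocalRing A] (C : Type u) [AddCommGroup C] [Module A C]

/-- The depth of a (finitely generated) module `C` over a local ring: the supremum of the lengths
of `C`-regular sequences in the maximal ideal. By Nakayama, weakly regular sequences in the maximal
ideal are regular if `C ≠ 0`; every sequence is weakly regular on `C = 0`, so `depth 0 = ∞`. -/
def localDepth : ℕ∞ :=
  ⨆ (rs : List A) (_ : RingTheory.Sequence.IsWeaklyRegular C rs ∧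
    ∀ x ∈ rs, x ∈ IsLocalRing.maximalIdeal A), (rs.length : ℕ∞)

/-- A canonical module of a (Cohen-Macaulay noetherian) local ring `A`: a finitely generated maximal
Cohen-Macaulay module of finite injective dimension and of type one, i.e.
`dim_k Ext^t(k, C) = 1` for `t = depth C` (the length over `A` of `Ext^t(k, C)` is its
dimension over the residue field `k`). -/
def IsLocalCanonicalModule : Prop :=
  Module.Finite A C ∧
  (IsLocalRing.maximalIdeal A).height ≤ localDepth A C ∧
  (∃ n : ℕ, HasInjectiveDimensionLE (ModuleCat.of A C) n) ∧
  ∃ t : ℕ, localDepth A C = t ∧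
    Module.length A (Abelian.Ext (ModuleCat.of A (IsLocalRing.ResidueField A))
      (ModuleCat.of A C) t) = 1

end LocalDepth

section Global

variable (R : Type u) [CommRing R] (M : Type u) [AddCommGroup M] [Module R M]

/-- `M` is maximal Cohen-Macaulay: `depth M_p ≥ height p` for all primes `p`
(`M` is meant to be finitely generated). A noetherian ring `R` is Cohen-Macaulay if and only if
`IsMCM R R`. -/
def IsMCM : Prop :=
  ∀ (p : Ideal R) [p.IsPrime],
    p.height ≤ localDepth (Localization.AtPrime p) (LocalizedModule p.primeCompl M)

/-- A canonical module of a Cohen-Macaulay ring `R`: a finitely generated module whose localization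
at every prime `p` is a canonical module of `R_p`. -/
def IsCanonicalModule : Prop :=
  Module.Finite R M ∧ ∀ (p : Ideal R) [p.IsPrime],
    IsLocalCanonicalModule (Localization.AtPrime p) (LocalizedModule p.primeCompl M)

/-- `M` is pseudo-zero: `M_p = 0` for all primes `p` of height at most one. -/
def IsPseudoZero : Prop :=
  ∀ (p : Ideal R) [p.IsPrime], p.height ≤ 1 → Subsingleton (LocalizedModule p.primeCompl M)

end Global

/-! ### The groups `G(R)` and `H(R)` -/

section Groups

variable (R : Type u) [CommRing R]

/-- The elements `[M₂] - [M₁] - [M₃]` for short exact sequences `0 → M₁ → M₂ → M₃ → 0` of finitely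
generated modules. -/
def exactRelations : Set (FreeAbelianGroup (FGModuleCat.{u} R)) :=
  {x | ∃ (M₁ M₂ M₃ : FGModuleCat.{u} R) (f : M₁ →ₗ[R] M₂) (g : M₂ →ₗ[R] M₃),
    Function.Injective f ∧ Function.Exact f g ∧ Function.Surjective g ∧
    x = FreeAbelianGroup.of M₂ - FreeAbelianGroup.of M₁ - FreeAbelianGroup.of M₃}

/-- The Grothendieck group `G(R)` of finitely generated `R`-modules. -/
abbrev G : Type (u + 1) :=
  FreeAbelianGroup (FGModuleCat.{u} R) ⧸ AddSubgroup.closure (exactRelations R)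

variable {R} in
/-- The class of a finitely generated module in `G(R)`. -/
def G.cls (M : FGModuleCat.{u} R) : G R :=
  QuotientAddGroup.mk (FreeAbelianGroup.of M)

/-- The quotient `H(R)` of `G(R)` by the subgroup generated by the classes of
pseudo-zero modules. -/
abbrev H : Type (u + 1) :=
  G R ⧸ AddSubgroup.closure {x : G R | ∃ M : FGModuleCat.{u} R, IsPseudoZero R M ∧ x = G.cls M}

variable {R} in
/-- The class of a finitely generated module in `H(R)`. -/
def H.cls (M : FGModuleCat.{u} R) : H R :=
  QuotientAddGroup.mk (G.cls M)

/-- The real vector space `H(R)_ℝ`. -/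
abbrev HR : Type (u + 1) := ℝ ⊗[ℤ] H R

variable {R} in
/-- The class of a finitely generated module in `H(R)_ℝ`. -/
def HR.cls (M : FGModuleCat.{u} R) : HR R := (1 : ℝ) ⊗ₜ[ℤ] H.cls M

end Groups

/-! ### The rank over a domain -/

section Rank

variable (R : Type u) [CommRing R]

section
variable [IsDomain R]

theorem finrank_exact {M₁ M₂ M₃ : FGModuleCat.{u} R} {f : M₁ →ₗ[R] M₂} {g : M₂ →ₗ[R] M₃}
    (hf : Function.Injective f) (hfg : Function.Exact f g) (hg : Function.Surjective g) :
    Module.finrank R M₂ = Module.finrank R M₁ + Module.finrank R M₃ := by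
  have h1 := Submodule.finrank_quotient_add_finrank (LinearMap.range f)
  have h2 : Module.finrank R (M₂ ⧸ LinearMap.range f) = Module.finrank R M₃ := by
    have e : LinearMap.range f = LinearMap.ker g := (LinearMap.exact_iff.mp hfg).symm
    rw [e]
    exact (g.quotKerEquivOfSurjective hg).finrank_eq
  have h3 : Module.finrank R (LinearMap.range f) = Module.finrank R M₁ :=
    LinearMap.finrank_range_of_inj hf
  omega

theorem finrank_of_isPseudoZero {M : FGModuleCat.{u} R} (h : IsPseudoZero R M) :
    Module.finrank R M = 0 := by
  have h0 : (⊥ : Ideal R).height ≤ 1 := by simp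
  have := h ⊥ h0
  rw [Module.finrank_eq_zero_iff]
  intro x
  have hx : LocalizedModule.mk x (1 : (⊥ : Ideal R).primeCompl) = 0 := Subsingleton.elim _ _
  rw [← LocalizedModule.zero_mk 1, LocalizedModule.mk_eq] at hx
  obtain ⟨c, hc⟩ := hx
  refine ⟨c.1, fun hz => c.2 (by simp [hz]), ?_⟩
  simpa [Submonoid.smul_def] using hc

/-- The rank function `G(R) → ℤ` of a domain, `[M] ↦ rank M`. -/
def rkG : G R →+ ℤ :=
  QuotientAddGroup.lift _ (FreeAbelianGroup.lift fun M => (Module.finrank R M : ℤ)) <| by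
    rw [AddSubgroup.closure_le]
    rintro _ ⟨M₁, M₂, M₃, f, g, hf, hfg, hg, rfl⟩
    have := finrank_exact R hf hfg hg
    simp only [SetLike.mem_coe, AddMonoidHom.mem_ker, map_sub, FreeAbelianGroup.lift_apply_of]
    omega

/-- The rank function `H(R) → ℤ` of a domain, `[M] ↦ rank M`. -/
def rk : H R →+ ℤ :=
  QuotientAddGroup.lift _ (rkG R) <| by
    rw [AddSubgroup.closure_le]
    rintro _ ⟨M, hM, rfl⟩
    have := finrank_of_isPseudoZero R hM
    simp [G.cls, rkG, this]

/-- The rank of a class in `H(R)` is the rank of the module. -/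
theorem rk_cls (M : FGModuleCat.{u} R) : rk R (H.cls M) = Module.finrank R M := by
  exact FreeAbelianGroup.lift_apply_of (fun M : FGModuleCat.{u} R => (Module.finrank R M : ℤ)) M

/-- The kernel `K(R)` of the rank function. -/
def K : AddSubgroup (H R) := (rk R).ker

/-- The subspace `K(R)_ℝ` of `H(R)_ℝ`: the image of `K(R) ⊗ ℝ`. -/
def KR : Submodule ℝ (HR R) :=
  LinearMap.range ((K R).subtype.toIntLinearMap.baseChange ℝ)

/-- The real extension `H(R)_ℝ → ℝ` of the rank function. -/
def rkR : HR R →ₗ[ℝ] ℝ :=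
  (TensorProduct.AlgebraTensorModule.rid ℤ ℝ ℝ).toLinearMap ∘ₗ
    (rk R).toIntLinearMap.baseChange ℝ

theorem rkR_tmul (a : ℝ) (x : H R) : rkR R (a ⊗ₜ x) = a * rk R x := by
  simp [rkR, mul_comm]

/-- `K(R)_ℝ` is the kernel of the real rank function. -/
theorem mem_KR_iff (x : HR R) : x ∈ KR R ↔ rkR R x = 0 := by
  constructor
  · rintro ⟨y, rfl⟩
    induction y using TensorProduct.induction_on with
    | zero => simp
    | tmul a k =>
      have hk : rk R (k : H R) = 0 := k.2
      simp [rkR_tmul, hk]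
    | add y z hy hz => simp [hy, hz]
  · intro h
    have key : ∀ y : HR R,
        y - rkR R y • HR.cls (FGModuleCat.of R R) ∈ KR R := by
      intro y
      induction y using TensorProduct.induction_on with
      | zero => simp
      | tmul a z =>
        have hz : z - rk R z • H.cls (FGModuleCat.of R R) ∈ K R := by
          change rk R _ = 0
          rw [map_sub, map_zsmul, rk_cls]
          simp
        refine ⟨a ⊗ₜ ⟨_, hz⟩, ?_⟩
        rw [LinearMap.baseChange_tmul, rkR_tmul]
        simp only [AddMonoidHom.coe_toIntLinearMap, AddSubgroup.coe_subtype, HR.cls,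
          TensorProduct.tmul_sub, TensorProduct.smul_tmul', TensorProduct.tmul_smul]
        congr 2
        simp [mul_comm]
      | add y z hy hz =>
        have := (KR R).add_mem hy hz
        rw [map_add, add_smul]
        convert this using 1
        abel
    have := key x
    rwa [h, zero_smul, sub_zero] at this

end

/-! ### Maximal Cohen-Macaulay points and cones -/

/-- The rank `r` maximal Cohen-Macaulay points of `H(R)_ℝ`. -/
def mcmPoints (r : ℕ) : Set (HR R) :=
  {x | ∃ M : FGModuleCat.{u} R, IsMCM R M ∧ Module.finrank R M = r ∧ x = HR.cls M}

/-- The convex cone `C_r(R)` in `H(R)_ℝ` spanned by the maximal Cohen-Macaulay modules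
of rank `r`. -/
def mcmCone (r : ℕ) : PointedCone ℝ (HR R) := PointedCone.hull ℝ (mcmPoints R r)

end Rank

/-! ### The Euclidean metric on `H(R)_ℝ` -/

/-- The Euclidean metric on `H(R)_ℝ` for which the basis `b` is orthonormal. -/
abbrev euclideanMetric {R : Type u} [CommRing R] {n : ℕ} (b : Module.Basis (Fin n) ℝ (HR R)) :
    MetricSpace (HR R) :=
  MetricSpace.induced (fun x => (WithLp.toLp 2 (b.equivFun x) : EuclideanSpace ℝ (Fin n)))
    ((WithLp.toLp_injective 2).comp b.equivFun.injective) inferInstance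

/-! ### The conditions -/

section Conditions

variable (R : Type u) [CommRing R] (r : ℕ)

/-- Up to isomorphism there are only finitely many maximal Cohen-Macaulay modules of rank `r`. -/
def FinitelyManyMCM : Prop :=
  ∃ S : Set (FGModuleCat.{u} R), S.Finite ∧
    ∀ M : FGModuleCat.{u} R, IsMCM R M → Module.finrank R M = r →
      ∃ N ∈ S, Nonempty (M ≃ₗ[R] N)

/-- There are only finitely many rank `r` maximal Cohen-Macaulay points in `C_r(R)`. -/
def FinitelyManyPoints : Prop := (mcmPoints R r ∩ (mcmCone R r : Set (HR R))).Finite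

/-- `C_r(R)` is polyhedral: it is spanned by finitely many vectors. -/
def ConePolyhedral : Prop := ∃ s : Finset (HR R), mcmCone R r = PointedCone.hull ℝ (s : Set (HR R))

variable {R} {n : ℕ} (b : Module.Basis (Fin n) ℝ (HR R))

/-- `C_r(R)` is a closed subset of `H(R)_ℝ`. -/
def ConeClosed : Prop :=
  letI := euclideanMetric b
  IsClosed (mcmCone R r : Set (HR R))

/-- The closure of `C_r(R)` in `H(R)_ℝ`. -/
def coneClosure : Set (HR R) :=
  letI := euclideanMetric b
  closure (mcmCone R r : Set (HR R))

/-- The closure of `C_r(R)` meets `K(R)_ℝ` only at the origin. -/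
def ClosureMeetsKTrivially [IsDomain R] : Prop := coneClosure r b ∩ (KR R : Set (HR R)) = {0}

/-- The set of the points of `C_r(R)` of rank `r` is bounded. -/
def SliceBounded [IsDomain R] : Prop :=
  letI := euclideanMetric b
  Bornology.IsBounded {x : HR R | x ∈ mcmCone R r ∧ rkR R x = r}

/-- The closure of `C_r(R)` is strongly convex: it meets its negative only at the origin. -/
def ClosureStronglyConvex : Prop :=
  {x : HR R | x ∈ coneClosure r b ∧ -x ∈ coneClosure r b} = {0}

end Conditions

end CMCone

end

noncomputable section

open CategoryTheory TensorProduct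

namespace CMCone

/-! ### Vanishing of `Ext` over local rings -/

section ExtVanishing

open Abelian RingTheory.Sequence IsLocalRing
open scoped Pointwise

variable {A : Type u} [CommRing A]

/-! Put ρ = rk/r. All rank r MCM points lie on the affine hyperplane ρ = 1, so C_r is the cone over
a convex subset of that hyperplane, and an element of C_r with ρ = 0 vanishes. The chain (b) to (g)
is convex geometry of such cones in finite dimension: a cone over a polytope is closed
(`isClosed_hull_of_finite`); the slice ρ = 1 is bounded iff ρ has no nontrivial zero on the closed
cone, by compactness of the unit sphere (`isBounded_slice`, `eq_zero_of_isBounded_slice`); and ρ ≥ 0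
on the closure, so x and -x both in the closure forces ρ(x) = 0.

If H(R) is finitely generated, H(R) → H(R)_ℝ has finite kernel and a lattice as image, so a bounded
slice contains only finitely many MCM points (`finite_setOf_tmul_mem`). This gives (f) ⇒ (b).

For R normal and r = 1, additivity of colengths of free submodules at height one primes defines a
divisor class on H(R). An MCM module is torsion-free and determined in codimension one
(`mem_range_of_isMCM`), so in rank one the divisor class determines it up to isomorphism
(`nonempty_linearEquiv_of_H_cls_eq`). This gives (b) ⇒ (a).

For (g) ⇒ (e), duality M ↦ Hom(M, ω) preserves the MCM modules of rank r: Ext^i(M, ω) = 0 for i > 0,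
so a regular sequence on ω stays regular on Hom(M, ω) (`isMCM_linearMap`). In H(R) one has [M] +
[Hom(M, ω)] = r([R] + [ω]), since a map and its transpose have the same determinant, hence the same
colength at every height one prime (`H_cls_linearMap_add`). So y ↦ ρ(y)w - y, with w = r([R] + [ω]),
preserves the closed cone and acts as -1 on K(R)_ℝ; the intersection of the two is symmetric, hence
zero under strong convexity. -/

theorem ext_middle_subsingleton {S : ShortComplex (ModuleCat.{u} A)} (hS : S.ShortExact)
    {C : ModuleCat.{u} A} {n : ℕ} (h1 : Subsingleton (Ext S.X₁ C n))
    (h3 : Subsingleton (Ext S.X₃ C n)) : Subsingleton (Ext S.X₂ C n) := by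
  refine subsingleton_of_forall_eq 0 fun x => ?_
  obtain ⟨z, rfl⟩ := Ext.contravariant_sequence_exact₂ hS C x (h1.elim _ _)
  rw [h3.elim z 0, Ext.comp_zero]

theorem ext_left_subsingleton {S : ShortComplex (ModuleCat.{u} A)} (hS : S.ShortExact)
    {C : ModuleCat.{u} A} {n : ℕ} (h2 : Subsingleton (Ext S.X₂ C n))
    (h3 : Subsingleton (Ext S.X₃ C (1 + n))) : Subsingleton (Ext S.X₁ C n) := by
  refine subsingleton_of_forall_eq 0 fun x => ?_
  obtain ⟨z, rfl⟩ := Ext.contravariant_sequence_exact₁ hS C x rfl (h3.elim _ _)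
  rw [h2.elim z 0, Ext.comp_zero]

theorem shortExact_of_linearMap {N₁ N₂ N₃ : Type u} [AddCommGroup N₁] [Module A N₁]
    [AddCommGroup N₂] [Module A N₂] [AddCommGroup N₃] [Module A N₃] {f : N₁ →ₗ[A] N₂}
    {g : N₂ →ₗ[A] N₃} (hf : Function.Injective f) (hfg : Function.Exact f g)
    (hg : Function.Surjective g) :
    (ShortComplex.mk (ModuleCat.ofHom f) (ModuleCat.ofHom g)
      (by ext x; exact hfg.apply_apply_eq_zero x)).ShortExact where
  exact := (ShortComplex.ShortExact.moduleCat_exact_iff_function_exact _).mpr hfg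
  mono_f := (ModuleCat.mono_iff_injective _).mpr hf
  epi_g := (ModuleCat.epi_iff_surjective _).mpr hg

theorem ext_right_subsingleton {S : ShortComplex (ModuleCat.{u} A)} (hS : S.ShortExact)
    {C : ModuleCat.{u} A} {n : ℕ} (h1 : Subsingleton (Ext S.X₁ C n))
    (h2 : Subsingleton (Ext S.X₂ C (1 + n))) : Subsingleton (Ext S.X₃ C (1 + n)) := by
  refine subsingleton_of_forall_eq 0 fun x => ?_
  obtain ⟨z, rfl⟩ := Ext.contravariant_sequence_exact₃ hS C x (h2.elim _ _) rfl
  rw [h1.elim z 0, Ext.comp_zero]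

theorem ext_quotSMulTop_subsingleton {N C : ModuleCat.{u} A} {y : A} (hy : IsSMulRegular N y) {n : ℕ}
    (h0 : Subsingleton (Ext N C n)) (h1 : Subsingleton (Ext N C (1 + n))) :
    Subsingleton (Ext (ModuleCat.of A (QuotSMulTop y N)) C (1 + n)) :=
  ext_right_subsingleton hy.smulShortComplex_shortExact h0 h1

/-- By the long exact sequence y acts surjectively on the finitely generated module Ext^n(N, C);
Nakayama then kills it. -/
theorem ext_subsingleton_of_quotSMulTop [IsNoetherianRing A] [IsLocalRing A]
    {N C : ModuleCat.{u} A} [Module.Finite A N] [Module.Finite A C] {y : A}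
    (hy : IsSMulRegular N y) (hm : y ∈ maximalIdeal A) {n : ℕ}
    (h : Subsingleton (Ext (ModuleCat.of A (QuotSMulTop y N)) C (1 + n))) :
    Subsingleton (Ext N C n) := by
  have key : (⊤ : Submodule A (Ext N C n)) ≤ maximalIdeal A • ⊤ := by
    intro x _
    obtain ⟨x₂, hx₂⟩ := Ext.contravariant_sequence_exact₁ hy.smulShortComplex_shortExact C x rfl
      (h.elim _ _)
    have : x = y • x₂ := by
      have h2 : ∀ z : Ext N C n, (Ext.mk₀ (y • 𝟙 N)).comp z (zero_add n) = y • z := fun z => by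
        rw [Ext.mk₀_smul, Ext.smul_comp, Ext.mk₀_id_comp]
      exact hx₂.symm.trans (h2 x₂)
    rw [this]
    exact Submodule.smul_mem_smul hm trivial
  have := Submodule.eq_bot_of_le_smul_of_le_jacobson_bot _ _ (Module.Finite.fg_top) key
    (maximalIdeal_le_jacobson _)
  exact (Submodule.subsingleton_iff A).mp (subsingleton_of_bot_eq_top this.symm)

theorem ext_congr_subsingleton {N N' : Type u} [AddCommGroup N] [Module A N] [AddCommGroup N']
    [Module A N'] (e : N ≃ₗ[A] N') (C : ModuleCat.{u} A) (n : ℕ)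
    (h : Subsingleton (Ext (ModuleCat.of A N) C n)) :
    Subsingleton (Ext (ModuleCat.of A N') C n) := by
  refine subsingleton_of_forall_eq 0 fun x => ?_
  have h1 : (Ext.mk₀ e.toModuleIso.hom).comp x (zero_add n) = 0 := h.elim _ _
  have h2 : x = (Ext.mk₀ e.toModuleIso.inv).comp ((Ext.mk₀ e.toModuleIso.hom).comp x (zero_add n))
      (zero_add n) := by
    rw [Ext.mk₀_comp_mk₀_assoc, Iso.inv_hom_id, Ext.mk₀_id_comp]
  rw [h2, h1, Ext.comp_zero]

/-- Each regular element raises the vanishing bound by at most one. Used for N = A, where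
projectivity gives k = 0. -/
theorem ext_quot_ofList_subsingleton {C : ModuleCat.{u} A} (rs : List A) (N : ModuleCat.{u} A)
    (hrs : IsWeaklyRegular N rs) {k : ℕ} (h : ∀ i > k, Subsingleton (Ext N C i)) :
    ∀ i > k + rs.length,
      Subsingleton (Ext (ModuleCat.of A (N ⧸ (Ideal.ofList rs • ⊤ : Submodule A N))) C i) := by
  induction rs generalizing N k with
  | nil =>
    intro i hi
    refine ext_congr_subsingleton (N := N) ?_ C i (h i (by simpa using hi))
    exact (Submodule.quotEquivOfEqBot _ (by simp)).symm
  | cons r rs ih =>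
    intro i hi
    rw [isWeaklyRegular_cons_iff] at hrs
    simp only [List.length_cons] at hi
    refine ext_congr_subsingleton
      (Submodule.quotOfListConsSMulTopEquivQuotSMulTopInner N r rs).symm C i
      (ih (ModuleCat.of A (QuotSMulTop r N)) hrs.2 (k := k + 1) ?_ i (by omega))
    intro j hj
    obtain ⟨j, rfl⟩ : ∃ j', j = 1 + j' := ⟨j - 1, by omega⟩
    exact ext_quotSMulTop_subsingleton hrs.1 (h j (by omega)) (h _ (by omega))


theorem exists_injective_residueField {Q : Type u} [IsLocalRing A] [AddCommGroup Q] [Module A Q]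
    {x : Q} (hx : ∀ a : A, a • x = 0 ↔ a ∈ maximalIdeal A) :
    ∃ f : (A ⧸ maximalIdeal A) →ₗ[A] Q, Function.Injective f := by
  have hk : LinearMap.ker (LinearMap.toSpanSingleton A Q x) = maximalIdeal A := by
    ext a
    simp [hx]
  refine ⟨(maximalIdeal A).liftQ (LinearMap.toSpanSingleton A Q x) hk.ge, ?_⟩
  rw [← LinearMap.ker_eq_bot, Submodule.ker_liftQ_eq_bot _ _ _ hk.le]

/-- A maximal `A`-regular sequence of length `dim A` has a cokernel containing the residue field. -/
theorem exists_injective_residueField_quot_ofList [IsNoetherianRing A] [IsLocalRing A]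
    {rs : List A} (hrs : IsWeaklyRegular A rs) (hm : ∀ x ∈ rs, x ∈ maximalIdeal A)
    (hd : (maximalIdeal A).height ≤ rs.length) :
    ∃ f : (A ⧸ maximalIdeal A) →ₗ[A] (A ⧸ (Ideal.ofList rs • ⊤ : Submodule A A)),
      Function.Injective f := by
  have hreg : IsRegular A rs :=
    (isRegular_iff_isWeaklyRegular_of_subset_maximalIdeal hm).mpr hrs
  have hdim := ringKrullDim_add_length_eq_ringKrullDim_of_isRegular rs hreg
  rw [← maximalIdeal_height_eq_ringKrullDim (R := A)] at hdim
  have hI : (Ideal.ofList rs • ⊤ : Submodule A A) = Ideal.ofList rs := by simp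
  rw [hI]
  have hle : Ideal.ofList rs ≤ maximalIdeal A := Ideal.span_le.mpr hm
  have hnt : Nontrivial (A ⧸ Ideal.ofList rs) :=
    Ideal.Quotient.nontrivial_iff.mpr fun h => (maximalIdeal.isMaximal A).ne_top (top_le_iff.mp (h ▸ hle))
  have h0 : ringKrullDim (A ⧸ Ideal.ofList rs) ≤ 0 := by
    rw [← ENat.WithBot.add_le_add_natCast_right_iff (c := rs.length), hdim, zero_add]
    exact_mod_cast hd
  have : Ring.KrullDimLE 0 (A ⧸ Ideal.ofList rs) := by
    rw [Ring.krullDimLE_iff]; exact_mod_cast h0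
  -- An associated prime of the quotient contains the ideal of `rs`. The quotient ring has dimension
  -- zero, so this prime is the maximal ideal and its witness x spans a copy of the residue field.
  obtain ⟨p, hp⟩ := associatedPrimes.nonempty A (A ⧸ Ideal.ofList rs)
  rw [AssociatedPrimes.mem_iff, IsAssociatedPrime, Submodule.isAssociatedPrime_iff] at hp
  obtain ⟨hpp, x, hpx⟩ := hp
  have hIp : Ideal.ofList rs ≤ p := by
    intro a ha
    rw [hpx, Submodule.mem_colon_singleton, Submodule.mem_bot]
    obtain ⟨y, rfl⟩ := Ideal.Quotient.mk_surjective x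
    rw [← Ideal.Quotient.mk_eq_mk, ← Submodule.Quotient.mk_smul, Submodule.Quotient.mk_eq_zero]
    exact Ideal.mul_mem_right _ _ ha
  have hmax : p.IsMaximal := by
    have h1 : (p.map (Ideal.Quotient.mk (Ideal.ofList rs))).IsPrime :=
      Ideal.map_isPrime_of_surjective Ideal.Quotient.mk_surjective (by simpa using hIp)
    have h2 : (p.map (Ideal.Quotient.mk (Ideal.ofList rs))).IsMaximal := inferInstance
    have h3 := Ideal.comap_isMaximal_of_surjective _ (K := p.map (Ideal.Quotient.mk (Ideal.ofList rs)))
      Ideal.Quotient.mk_surjective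
    rwa [Ideal.comap_map_of_surjective' _ Ideal.Quotient.mk_surjective, Ideal.mk_ker,
      sup_eq_left.mpr hIp] at h3
  have hpm := IsLocalRing.eq_maximalIdeal hmax
  refine exists_injective_residueField (x := x) fun a => ?_
  rw [← hpm, hpx, Submodule.mem_colon_singleton, Submodule.mem_bot]

/-- Over a Cohen-Macaulay local ring of dimension at most `d`, the groups `Ext^i(-, C)` with `i > d`
vanish on finitely generated modules if `C` is finitely generated of finite injective dimension. -/
theorem ext_subsingleton_of_hasInjectiveDimensionLE [IsNoetherianRing A] [IsLocalRing A]
    {rs : List A} (hrs : IsWeaklyRegular A rs) (hm : ∀ x ∈ rs, x ∈ maximalIdeal A)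
    (hd : (maximalIdeal A).height ≤ rs.length) (C : ModuleCat.{u} A) [Module.Finite A C] {n₀ : ℕ}
    [HasInjectiveDimensionLE C n₀] {i : ℕ} (hi : rs.length < i) (N : Type u) [AddCommGroup N]
    [Module A N] [Module.Finite A N] : Subsingleton (Ext (ModuleCat.of A N) C i) := by
  -- Descending induction on i: above n₀ the injective dimension suffices, and below it vanishing is
  -- already known in degree 1 + i for every finitely generated module.
  induction h : n₀ + 1 - i generalizing i N with
  | zero => exact HasInjectiveDimensionLT.subsingleton C (n₀ + 1) i (by omega) _
  | succ k ih =>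
    have V : ∀ (N : Type u) [AddCommGroup N] [Module A N] [Module.Finite A N],
        Subsingleton (Ext (ModuleCat.of A N) C (1 + i)) := fun N _ _ _ =>
      ih (by omega) N (by omega)
    -- The residue field embeds in A/(rs), whose Ext vanishes in degree i > `rs.length`; the
    -- obstruction lies in Ext^(1+i) of the cokernel, which vanishes by V.
    have hres : Subsingleton (Ext (ModuleCat.of A (A ⧸ maximalIdeal A)) C i) := by
      obtain ⟨f, hf⟩ := exists_injective_residueField_quot_ofList hrs hm hd
      refine ext_left_subsingleton (shortExact_of_linearMap hf (LinearMap.exact_map_mkQ_range f)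
        (Submodule.mkQ_surjective _)) ?_ (V _)
      refine ext_quot_ofList_subsingleton rs (ModuleCat.of A A) hrs (k := 0) (fun j hj => ?_) i
        (by omega)
      obtain ⟨j, rfl⟩ : ∃ j', j = j' + 1 := ⟨j - 1, by omega⟩
      exact subsingleton_of_forall_eq 0 fun x => Ext.eq_zero_of_projective x
    -- Prime filtration reduces to A/p. If p is not maximal, some y in the maximal ideal outside p
    -- is regular on A/p, and Nakayama descends from degree 1 + i.
    induction ‹Module.Finite A N› using
      IsNoetherianRing.induction_on_isQuotientEquivQuotientPrime A with
    | subsingleton N =>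
      refine subsingleton_of_forall_eq 0 fun x => ?_
      have h0 : 𝟙 (ModuleCat.of A N) = 0 := by
        ext x
        exact Subsingleton.elim _ _
      rw [← Ext.mk₀_id_comp x, h0, Ext.mk₀_zero, Ext.zero_comp]
    | quotient N p f =>
      refine ext_congr_subsingleton f.symm C i ?_
      by_cases hp : p.1 = maximalIdeal A
      · rw [hp]
        exact hres
      · obtain ⟨y, hym, hyp⟩ := SetLike.exists_of_lt
          (lt_of_le_of_ne (le_maximalIdeal p.2.ne_top) hp)
        refine ext_subsingleton_of_quotSMulTop (y := y) (N := ModuleCat.of A (A ⧸ p.1)) ?_ hym (V _)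
        rw [isSMulRegular_quotient_iff_mem_of_smul_mem]
        intro x hx
        exact (p.2.mem_or_mem hx).resolve_left hyp
    | exact N₁ N₂ N₃ f g hf hg hfg h₁ h₃ =>
      exact ext_middle_subsingleton (shortExact_of_linearMap hf hfg hg) h₁ h₃

/-- Every regular element on N lowers the vanishing bound by one, by Nakayama. With a regular
sequence of length d, all positive degrees vanish. -/
theorem ext_subsingleton_of_isWeaklyRegular [IsNoetherianRing A] [IsLocalRing A]
    (C : ModuleCat.{u} A) [Module.Finite A C] {d : ℕ}
    (h : ∀ i > d, ∀ (N : Type u) [AddCommGroup N] [Module A N] [Module.Finite A N],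
      Subsingleton (Ext (ModuleCat.of A N) C i))
    (rs : List A) (hm : ∀ x ∈ rs, x ∈ maximalIdeal A) (N : ModuleCat.{u} A) [Module.Finite A N]
    (hrs : IsWeaklyRegular N rs) {i : ℕ} (hi : d < i + rs.length) : Subsingleton (Ext N C i) := by
  induction rs generalizing N i with
  | nil => exact h i (by simpa using hi) N
  | cons r rs ih =>
    rw [isWeaklyRegular_cons_iff] at hrs
    simp only [List.mem_cons, forall_eq_or_imp, List.length_cons] at hm hi
    exact ext_subsingleton_of_quotSMulTop hrs.1 hm.1
      (ih hm.2 (ModuleCat.of A (QuotSMulTop r N)) hrs.2 (by omega))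

theorem ext_covariant_quotSMulTop_subsingleton {N C : ModuleCat.{u} A} {y : A}
    (hy : IsSMulRegular C y) {n : ℕ} (h0 : Subsingleton (Ext N C n))
    (h1 : Subsingleton (Ext N C (n + 1))) :
    Subsingleton (Ext N (ModuleCat.of A (QuotSMulTop y C)) n) := by
  have key : ∀ (S : ShortComplex (ModuleCat.{u} A)), S.ShortExact → Subsingleton (Ext N S.X₂ n) →
      Subsingleton (Ext N S.X₁ (n + 1)) → Subsingleton (Ext N S.X₃ n) := by
    intro S hS h2 h1
    refine subsingleton_of_forall_eq 0 fun x => ?_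
    obtain ⟨z, rfl⟩ := Ext.covariant_sequence_exact₃ N hS x rfl (h1.elim _ _)
    rw [h2.elim z 0, Ext.zero_comp]
  exact key _ hy.smulShortComplex_shortExact h0 h1

theorem exists_lift_of_ext_one_subsingleton {S : ShortComplex (ModuleCat.{u} A)} (hS : S.ShortExact)
    {N : ModuleCat.{u} A} (h : Subsingleton (Ext N S.X₁ 1)) (φ : N ⟶ S.X₃) :
    ∃ ψ : N ⟶ S.X₂, ψ ≫ S.g = φ := by
  obtain ⟨z, hz⟩ := Ext.covariant_sequence_exact₃ N hS (Ext.mk₀ φ) rfl (h.elim _ _)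
  obtain ⟨ψ, rfl⟩ := Ext.addEquiv₀.symm.surjective z
  refine ⟨ψ, Ext.addEquiv₀.symm.injective ?_⟩
  simpa using hz

/-! ### Regular sequences on Hom modules, and depth -/

variable {N C : Type u} [AddCommGroup N] [Module A N] [AddCommGroup C] [Module A C]

theorem isSMulRegular_linearMap {y : A} (hy : IsSMulRegular C y) :
    IsSMulRegular (N →ₗ[A] C) y := by
  intro f g hfg
  ext x
  exact hy (LinearMap.congr_fun hfg x)

/-- `Hom(N, C) / y Hom(N, C) ≃ Hom(N, C / y C)` if `y` is regular on `C` and `Ext^1(N, C) = 0`. -/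
def quotSMulTopLinearMapEquiv {y : A} (hy : IsSMulRegular C y)
    (h : Subsingleton (Ext (ModuleCat.of A N) (ModuleCat.of A C) 1)) :
    QuotSMulTop y (N →ₗ[A] C) ≃ₗ[A] (N →ₗ[A] QuotSMulTop y C) := by
  let F : (N →ₗ[A] C) →ₗ[A] (N →ₗ[A] QuotSMulTop y C) :=
    LinearMap.compRight A (Submodule.mkQ _)
  have hker : LinearMap.ker F = y • (⊤ : Submodule A (N →ₗ[A] C)) := by
    ext f
    rw [LinearMap.mem_ker, Submodule.mem_smul_pointwise_iff_exists]
    constructor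
    · intro hf
      have h1 : ∀ x, ∃ c : C, y • c = f x := by
        intro x
        have := LinearMap.congr_fun hf x
        simp only [F, LinearMap.compRight_apply, LinearMap.comp_apply, Submodule.mkQ_apply,
          LinearMap.zero_apply, Submodule.Quotient.mk_eq_zero,
          Submodule.mem_smul_pointwise_iff_exists] at this
        obtain ⟨c, -, hc⟩ := this
        exact ⟨c, hc⟩
      choose g hg using h1
      -- The pointwise quotient g of f by y is linear because y is regular on C.
      refine ⟨⟨⟨g, fun a b => hy ?_⟩, fun a b => hy ?_⟩, trivial, ?_⟩
      · simp only [smul_add, hg, map_add]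
      · simp only [RingHom.id_apply, smul_comm y a, hg, map_smul]
      · ext x
        exact hg x
    · rintro ⟨g, -, rfl⟩
      ext x
      simp only [F, LinearMap.compRight_apply, LinearMap.comp_apply, Submodule.mkQ_apply,
          LinearMap.zero_apply, Submodule.Quotient.mk_eq_zero]
      exact Submodule.smul_mem_pointwise_smul _ _ _ trivial
  have hsurj : Function.Surjective F := by
    intro φ
    obtain ⟨ψ, hψ⟩ := exists_lift_of_ext_one_subsingleton
      (IsSMulRegular.smulShortComplex_shortExact (M := ModuleCat.of A C) hy) h (ModuleCat.ofHom φ)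
    refine ⟨ψ.hom, ?_⟩
    ext x
    exact LinearMap.congr_fun (congr_arg ModuleCat.Hom.hom hψ) x
  exact (Submodule.quotEquivOfEq _ _ hker.symm).trans (F.quotKerEquivOfSurjective hsurj)

/-- Induction on the sequence: Hom(N, C)/y is Hom(N, C/yC), and the vanishing of Ext^i(N, -) for i >
0 passes from C to C/yC. -/
theorem isWeaklyRegular_linearMap {rs : List A} (hrs : IsWeaklyRegular C rs)
    (h : ∀ i > 0, Subsingleton (Ext (ModuleCat.of A N) (ModuleCat.of A C) i)) :
    IsWeaklyRegular (N →ₗ[A] C) rs := by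
  induction rs generalizing C with
  | nil => exact IsWeaklyRegular.nil _ _
  | cons r rs ih =>
    rw [isWeaklyRegular_cons_iff] at hrs ⊢
    refine ⟨isSMulRegular_linearMap hrs.1, ?_⟩
    rw [(quotSMulTopLinearMapEquiv hrs.1 (h 1 one_pos)).isWeaklyRegular_congr]
    exact ih hrs.2 fun i hi =>
      ext_covariant_quotSMulTop_subsingleton (C := ModuleCat.of A C) hrs.1 (h i hi) (h _ (by omega))

/-- The supremum need not be attained (it is infinite for the zero module), so a sequence longer
than d - 1 is chosen and truncated; prefixes stay weakly regular. -/
theorem exists_isWeaklyRegular_of_le_localDepth [IsLocalRing A] {d : ℕ}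
    (h : (d : ℕ∞) ≤ localDepth A C) :
    ∃ rs : List A, IsWeaklyRegular C rs ∧ (∀ x ∈ rs, x ∈ maximalIdeal A) ∧ rs.length = d := by
  obtain rfl | hd := Nat.eq_zero_or_pos d
  · exact ⟨[], IsWeaklyRegular.nil _ _, by simp, rfl⟩
  have h1 : ((d - 1 : ℕ) : ℕ∞) < localDepth A C :=
    lt_of_lt_of_le (by exact_mod_cast (by omega : d - 1 < d)) h
  rw [localDepth, lt_iSup_iff] at h1
  obtain ⟨rs, h1⟩ := h1
  rw [lt_iSup_iff] at h1
  obtain ⟨⟨hrs, hm⟩, h1⟩ := h1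
  have h2 : d ≤ rs.length := by
    have : d - 1 < rs.length := by exact_mod_cast h1
    omega
  refine ⟨rs.take d, ?_, fun x hx => hm x (List.mem_of_mem_take hx), by simpa using h2⟩
  have := List.take_append_drop d rs
  rw [← this, isWeaklyRegular_append_iff] at hrs
  exact hrs.1

theorem le_localDepth [IsLocalRing A] {rs : List A} (hrs : IsWeaklyRegular C rs)
    (hm : ∀ x ∈ rs, x ∈ maximalIdeal A) : (rs.length : ℕ∞) ≤ localDepth A C :=
  le_iSup₂_of_le rs ⟨hrs, hm⟩ le_rfl

theorem localDepth_congr [IsLocalRing A] (e : N ≃ₗ[A] C) : localDepth A N = localDepth A C := by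
  simp only [localDepth, e.isWeaklyRegular_congr]

/-- Over a Cohen-Macaulay local ring, the dual of a maximal Cohen-Macaulay module with values in a
maximal Cohen-Macaulay module of finite injective dimension is maximal Cohen-Macaulay. -/
theorem height_le_localDepth_linearMap [IsNoetherianRing A] [IsLocalRing A] [Module.Finite A N]
    [Module.Finite A C] (hA : (maximalIdeal A).height ≤ localDepth A A)
    (hN : (maximalIdeal A).height ≤ localDepth A N) (hC : (maximalIdeal A).height ≤ localDepth A C)
    {n : ℕ} (hn : HasInjectiveDimensionLE (ModuleCat.of A C) n) :
    (maximalIdeal A).height ≤ localDepth A (N →ₗ[A] C) := by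
  obtain ⟨d, hd⟩ := ENat.ne_top_iff_exists.mp
    (Ideal.height_ne_top (maximalIdeal.isMaximal A).ne_top)
  rw [← hd] at hA hN hC ⊢
  obtain ⟨as, has, hasm, hasd⟩ := exists_isWeaklyRegular_of_le_localDepth hA
  obtain ⟨ns, hns, hnsm, hnsd⟩ := exists_isWeaklyRegular_of_le_localDepth hN
  obtain ⟨cs, hcs, hcsm, hcsd⟩ := exists_isWeaklyRegular_of_le_localDepth hC
  have hext : ∀ i > 0, Subsingleton (Ext (ModuleCat.of A N) (ModuleCat.of A C) i) := fun i hi =>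
    ext_subsingleton_of_isWeaklyRegular (ModuleCat.of A C) (d := d)
      (fun j hj N _ _ _ => ext_subsingleton_of_hasInjectiveDimensionLE has hasm
        (by rw [hasd, hd]) (n₀ := n) _ (hasd ▸ hj) N) ns hnsm (ModuleCat.of A N) hns (by omega)
  have := le_localDepth (isWeaklyRegular_linearMap hcs hext) hcsm
  rwa [hcsd] at this

end ExtVanishing


/-! ### Localization of maximal Cohen-Macaulay modules -/

section LocalizationMCM

open IsLocalRing RingTheory.Sequence
open scoped Pointwise nonZeroDivisors

variable {R : Type u} [CommRing R]

theorem height_maximalIdeal_atPrime (p : Ideal R) [p.IsPrime] :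
    (maximalIdeal (Localization.AtPrime p)).height = p.height := by
  have h1 := IsLocalization.AtPrime.ringKrullDim_eq_height p (Localization.AtPrime p)
  rw [← maximalIdeal_height_eq_ringKrullDim] at h1
  exact_mod_cast h1

def localizedModuleSelfEquiv (S : Submonoid R) : LocalizedModule S R ≃ₗ[Localization S] Localization S :=
  (IsLocalizedModule.linearEquiv S (LocalizedModule.mkLinearMap S R)
    (Algebra.linearMap R (Localization S))).extendScalarsOfIsLocalization S (Localization S)

variable {M N : Type u} [AddCommGroup M] [Module R M] [AddCommGroup N] [Module R N]

def localizedModuleLinearMapEquiv [IsNoetherianRing R] [Module.Finite R M] (S : Submonoid R) :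
    LocalizedModule S (M →ₗ[R] N) ≃ₗ[Localization S]
      (LocalizedModule S M →ₗ[Localization S] LocalizedModule S N) :=
  haveI := Module.finitePresentation_of_finite R M
  (IsLocalizedModule.linearEquiv S (LocalizedModule.mkLinearMap S (M →ₗ[R] N))
    (LocalizedModule.map S)).extendScalarsOfIsLocalization S (Localization S)

/-- The dual of a maximal Cohen-Macaulay module with values in a canonical module is maximal
Cohen-Macaulay. -/
theorem isMCM_linearMap [IsNoetherianRing R] [Module.Finite R M] (hR : IsMCM R R) (hM : IsMCM R M)
    (hN : IsCanonicalModule R N) : IsMCM R (M →ₗ[R] N) := by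
  intro p hp
  obtain ⟨hfin, h1, ⟨n, hn⟩, -⟩ := hN.2 p
  have h2 := hR p
  rw [localDepth_congr (localizedModuleSelfEquiv p.primeCompl)] at h2
  have h3 := hM p
  rw [← height_maximalIdeal_atPrime] at h2 h3 ⊢
  rw [localDepth_congr (localizedModuleLinearMapEquiv p.primeCompl)]
  exact height_le_localDepth_linearMap h2 h3 h1 hn

/-! ### Ranks of canonical modules and of Hom modules -/

theorem localDepth_of_isField {A : Type u} [CommRing A] [IsLocalRing A] (hA : maximalIdeal A = ⊥)
    (C : Type u) [AddCommGroup C] [Module A C] [Nontrivial C] : localDepth A C = 0 := by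
  by_contra h
  have h1 : ((1 : ℕ) : ℕ∞) ≤ localDepth A C := by
    rw [Nat.cast_one]
    exact Order.one_le_iff_ne_zero.mpr h
  obtain ⟨rs, hrs, hm, hl⟩ := exists_isWeaklyRegular_of_le_localDepth h1
  obtain ⟨x, rfl⟩ := List.length_eq_one_iff.mp hl
  rw [isWeaklyRegular_cons_iff] at hrs
  have hx : x = 0 := by
    have := hm x (by simp)
    rwa [hA] at this
  obtain ⟨y, hy⟩ := exists_ne (0 : C)
  exact hy (hrs.1 (by simp [hx]))

theorem localDepth_of_subsingleton {A : Type u} [CommRing A] [IsLocalRing A]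
    (C : Type u) [AddCommGroup C] [Module A C] [Subsingleton C] : localDepth A C = ⊤ := by
  rw [ENat.eq_top_iff_forall_ge]
  intro n
  have : IsWeaklyRegular C (List.replicate n (0 : A)) := by
    rw [isWeaklyRegular_iff]
    intro i hi
    exact Function.injective_of_subsingleton _
  have h := le_localDepth this (fun x hx => by simp [List.eq_of_mem_replicate hx])
  simpa using h

/-- Over a field, a canonical module is one-dimensional. -/
theorem IsLocalCanonicalModule.finrank_eq_one {A : Type u} [CommRing A] [IsLocalRing A]
    (hA : IsField A) {C : Type u} [AddCommGroup C] [Module A C] (h : IsLocalCanonicalModule A C) :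
    Module.finrank A C = 1 := by
  obtain ⟨-, -, -, t, ht, hl⟩ := h
  have hbot : maximalIdeal A = ⊥ := isField_iff_maximalIdeal_eq.mp hA
  let := hA.toField
  -- C = 0 is excluded because its depth is infinite, whereas t is a natural number. Otherwise t =
  -- 0, and Ext^0(k, C) is C itself.
  rcases subsingleton_or_nontrivial C with hs | hn
  · rw [localDepth_of_subsingleton] at ht
    exact absurd ht (by simp)
  · rw [localDepth_of_isField hbot] at ht
    obtain rfl : t = 0 := by exact_mod_cast ht.symm
    let e₁ : ModuleCat.of A (ResidueField A) ≅ ModuleCat.of A A :=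
      ((Submodule.quotEquivOfEqBot (maximalIdeal A) hbot) : _ ≃ₗ[A] A).toModuleIso
    have e : Abelian.Ext (ModuleCat.of A (ResidueField A)) (ModuleCat.of A C) 0 ≃ₗ[A] C :=
      Abelian.Ext.linearEquiv₀.trans (ModuleCat.homLinearEquiv.trans
        ((e₁.toLinearEquiv.congrLeft C A).trans (LinearMap.ringLmapEquivSelf A A C)))
    rw [e.length_eq] at hl
    have hA1 : Module.length A A = 1 := by
      rw [Module.length_eq_one_iff]
      infer_instance
    rw [Module.length_of_free, hA1, mul_one] at hl
    simp only [Cardinal.toENat_eq_one] at hl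
    simp [Module.finrank, hl]

/-- Localize at the zero ideal: over the field of fractions, type one means dimension one. -/
theorem finrank_of_isCanonicalModule [IsDomain R] (h : IsCanonicalModule R N) :
    Module.finrank R N = 1 := by
  have hle : (⊥ : Ideal R).primeCompl ≤ R⁰ := fun x hx => mem_nonZeroDivisors_of_ne_zero hx
  have h1 := IsLocalizedModule.finrank_eq (Ideal.primeCompl (⊥ : Ideal R))
    (LocalizedModule.mkLinearMap (Ideal.primeCompl (⊥ : Ideal R)) N) hle
  have h2 := IsLocalization.finrank_eq (Localization.AtPrime (⊥ : Ideal R))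
    (N := LocalizedModule (Ideal.primeCompl (⊥ : Ideal R)) N) _ hle
  rw [← h1, ← h2]
  refine (h.2 ⊥).finrank_eq_one ?_
  have h3 := height_maximalIdeal_atPrime (⊥ : Ideal R)
  rw [Ideal.height_bot] at h3
  have : IsDomain (Localization.AtPrime (⊥ : Ideal R)) := inferInstance
  rw [isField_iff_maximalIdeal_eq]
  exact Ideal.height_eq_zero_iff_eq_bot.mp h3

theorem finrank_linearMap_of_isDomain [IsDomain R] [IsNoetherianRing R] [Module.Finite R M]
    [Module.Finite R N] :
    Module.finrank R (M →ₗ[R] N) = Module.finrank R M * Module.finrank R N := by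
  have h (X : Type u) [AddCommGroup X] [Module R X] :
      Module.finrank (FractionRing R) (LocalizedModule R⁰ X) = Module.finrank R X := by
    rw [IsLocalization.finrank_eq (FractionRing R) R⁰ le_rfl]
    exact IsLocalizedModule.finrank_eq R⁰ (LocalizedModule.mkLinearMap R⁰ X) le_rfl
  rw [← h, ← h M, ← h N, (localizedModuleLinearMapEquiv R⁰).finrank_eq]
  exact Module.finrank_linearMap _ _ _ _

theorem isDiscreteValuationRing_atPrime [IsDomain R] [IsNoetherianRing R] [IsIntegrallyClosed R]
    (p : Ideal R) [p.IsPrime] (hp : p.height = 1) :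
    IsDiscreteValuationRing (Localization.AtPrime p) := by
  have hic : IsIntegrallyClosed (Localization.AtPrime p) :=
    isIntegrallyClosed_of_isLocalization _ p.primeCompl p.primeCompl_le_nonZeroDivisors
  have hm := height_maximalIdeal_atPrime p
  rw [hp] at hm
  have hf : ¬ IsField (Localization.AtPrime p) := by
    rw [isField_iff_maximalIdeal_eq]
    exact Ideal.ne_bot_of_height_eq_one hm
  have htfae : IsDiscreteValuationRing (Localization.AtPrime p) ↔
      (IsIntegrallyClosed (Localization.AtPrime p) ∧
        ∃! P : Ideal (Localization.AtPrime p), P ≠ ⊥ ∧ P.IsPrime) :=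
    (IsDiscreteValuationRing.TFAE _ hf).out 0 3
  refine htfae.mpr ⟨hic, maximalIdeal _, ⟨Ideal.ne_bot_of_height_eq_one hm, inferInstance⟩, ?_⟩
  rintro P ⟨hP, hPp⟩
  by_contra hne
  have hlt : P < maximalIdeal (Localization.AtPrime p) :=
    lt_of_le_of_ne (le_maximalIdeal hPp.ne_top) hne
  have h1 := Ideal.height_add_one_le_of_lt_of_isPrime hlt
  rw [hm] at h1
  have h2 : P.height = 0 := by
    by_contra h0
    have h3 : (1 : ℕ∞) + 1 ≤ P.height + 1 := by
      gcongr
      exact Order.one_le_iff_ne_zero.mpr h0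
    replace h3 := h3.trans h1
    exact absurd h3 (by decide)
  exact hP (Ideal.height_eq_zero_iff_eq_bot.mp h2)

/-! ### Serre's conditions -/

/-- Clearing denominators turns divisibility by a' in M_p into divisibility by its numerator a in M,
up to a factor outside p. -/
theorem exists_notMem_smul_eq_of_localizedModule {p : Ideal R} [p.IsPrime] {m : M} {a : R}
    {a' : Localization.AtPrime p} {s : R} (hs : s ∉ p)
    (has : algebraMap R _ s * a' = algebraMap R _ a)
    (w : LocalizedModule p.primeCompl M) (h : LocalizedModule.mk m 1 = a' • w) :
    ∃ v ∉ p, ∃ m'' : M, v • m = a • m'' := by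
  induction w using LocalizedModule.induction_on with
  | h x t =>
    have h1 : (s * t) • LocalizedModule.mk m (1 : p.primeCompl) = LocalizedModule.mk (a • x) 1 := by
      rw [h, mul_comm s, mul_smul, ← algebraMap_smul (Localization.AtPrime p) s, smul_smul, has,
        algebraMap_smul, smul_comm, ← LocalizedModule.mk_cancel t (a • x)]
      simp only [LocalizedModule.smul'_mk, Submonoid.smul_def]
      rw [smul_comm]
    rw [LocalizedModule.smul'_mk, LocalizedModule.mk_eq] at h1
    obtain ⟨c, hc⟩ := h1
    simp only [one_smul, Submonoid.smul_def] at hc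
    refine ⟨c * (s * t), ?_, c.1 • x, ?_⟩
    · exact (p.primeCompl.mul_mem c.2 (p.primeCompl.mul_mem hs t.2))
    · rw [mul_smul, hc, smul_comm]

theorem exists_eq_smul_of_mem_maximalIdeal {p : Ideal R} [p.IsPrime] {a' : Localization.AtPrime p}
    (ha : a' ∈ maximalIdeal (Localization.AtPrime p)) :
    ∃ a ∈ p, ∃ s ∉ p, algebraMap R _ s * a' = algebraMap R _ a := by
  obtain ⟨a, s, rfl⟩ := IsLocalization.exists_mk'_eq p.primeCompl a'
  refine ⟨a, ?_, s, s.2, IsLocalization.mk'_spec' _ _ _⟩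
  rwa [IsLocalization.AtPrime.mk'_mem_maximal_iff _ p] at ha

theorem eq_zero_of_localizedModule_mk {p : Ideal R} [p.IsPrime] {m : M}
    (h : LocalizedModule.mk m (1 : p.primeCompl) = 0) : ∃ v ∉ p, v • m = 0 := by
  rw [← LocalizedModule.zero_mk 1, LocalizedModule.mk_eq] at h
  obtain ⟨c, hc⟩ := h
  exact ⟨c, c.2, by simpa [Submonoid.smul_def] using hc⟩

/-- Given a nonzero element `x` of a module, some multiple `r • x` has a prime annihilator. -/
theorem exists_isPrime_forall_mem_iff_smul_eq_zero [IsNoetherianRing R] {L : Type*}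
    [AddCommGroup L] [Module R L] {x : L} (hx : x ≠ 0) :
    ∃ (P : Ideal R) (_ : P.IsPrime) (r : R), (∀ a : R, a • x = 0 → a ∈ P) ∧
      ∀ a : R, a ∈ P ↔ a • r • x = 0 := by
  have hx' : (⟨x, Submodule.mem_span_singleton_self x⟩ : Submodule.span R {x}) ≠ 0 := by
    simpa using hx
  obtain ⟨P, hP, hle⟩ := exists_le_isAssociatedPrime_of_isNoetherianRing R _ hx'
  rw [isAssociatedPrime_iff] at hP
  obtain ⟨hPp, ⟨y, hy⟩, hPy⟩ := hP
  obtain ⟨r, rfl⟩ := Submodule.mem_span_singleton.mp hy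
  refine ⟨P, hPp, r, fun a ha => hle ?_, fun a => ?_⟩
  · rw [Submodule.mem_colon_singleton, Submodule.mem_bot]
    simpa using ha
  · rw [hPy, Submodule.mem_colon_singleton, Submodule.mem_bot]
    simp

/-- A nonzero torsion element has a multiple cx with prime annihilator P ≠ 0. Then depth M_P ≥ 1
gives an M_P-regular element of the maximal ideal, yet it kills the nonzero image of cx. -/
theorem isTorsionFree_of_isMCM [IsDomain R] [IsNoetherianRing R] (hM : IsMCM R M) :
    Module.IsTorsionFree R M := by
  rw [Module.isTorsionFree_iff_smul_eq_zero]
  intro r x hrx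
  by_contra! hne
  obtain ⟨hr, hx⟩ := hne
  obtain ⟨P, hPp, c, hP1, hP⟩ := exists_isPrime_forall_mem_iff_smul_eq_zero (R := R) hx
  have h1 : ((1 : ℕ) : ℕ∞) ≤ P.height := by
    rw [Nat.cast_one, Order.one_le_iff_ne_zero, Ne, Ideal.height_eq_zero_iff_eq_bot]
    rintro rfl
    exact hr (hP1 r hrx)
  obtain ⟨rs, hrs, hm, hl⟩ := exists_isWeaklyRegular_of_le_localDepth (h1.trans (hM P))
  obtain ⟨a', rfl⟩ := List.length_eq_one_iff.mp hl
  rw [isWeaklyRegular_cons_iff] at hrs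
  obtain ⟨a, ha, s, hs, has⟩ := exists_eq_smul_of_mem_maximalIdeal (hm a' (by simp))
  have h2 : a' • LocalizedModule.mk (s • c • x) (1 : P.primeCompl) = a' • 0 := by
    rw [← LocalizedModule.smul'_mk, ← algebraMap_smul (Localization.AtPrime P) s, smul_smul,
      mul_comm, has, algebraMap_smul, LocalizedModule.smul'_mk, (hP a).mp ha, smul_zero,
      LocalizedModule.zero_mk]
  obtain ⟨v, hv, hvs⟩ := eq_zero_of_localizedModule_mk (hrs.1 h2)
  rw [smul_smul, ← hP] at hvs
  exact (hPp.mem_or_mem hvs).elim hv hs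

/-- A maximal Cohen-Macaulay submodule of a torsion-free module is determined in codimension one. -/
theorem mem_range_of_isMCM [IsDomain R] [IsNoetherianRing R] (hM : IsMCM R M)
    {V : Type*} [AddCommGroup V] [Module R V] [Module.IsTorsionFree R V] {g : M →ₗ[R] V}
    (hg : Function.Injective g) {x : V}
    (hx : ∀ (p : Ideal R) [p.IsPrime], p.height ≤ 1 → ∃ t ∉ p, t • x ∈ LinearMap.range g) :
    x ∈ LinearMap.range g := by
  by_contra hne
  have hx0 : (LinearMap.range g).mkQ x ≠ 0 := by simpa using hne
  obtain ⟨P, hPp, c, hP1, hP⟩ := exists_isPrime_forall_mem_iff_smul_eq_zero (R := R) hx0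
  replace hP : ∀ a : R, a ∈ P ↔ a • c • x ∈ LinearMap.range g := by
    intro a
    rw [hP, ← map_smul, ← map_smul, Submodule.mkQ_apply, Submodule.Quotient.mk_eq_zero]
  -- P is the annihilator of cx modulo the range of g. The hypothesis on x excludes height at most
  -- one, so M_P has depth at least two.
  have h2 : ((2 : ℕ) : ℕ∞) ≤ P.height := by
    by_contra! hlt
    obtain ⟨t, ht, htx⟩ := hx P (Order.le_of_lt_succ hlt)
    exact ht ((hP t).mpr (by rw [smul_comm]; exact Submodule.smul_mem _ _ htx))
  obtain ⟨rs, hrs, hm, hl⟩ := exists_isWeaklyRegular_of_le_localDepth (h2.trans (hM P))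
  obtain ⟨a', b', rfl⟩ := List.length_eq_two.mp hl
  rw [isWeaklyRegular_cons_iff, isWeaklyRegular_cons_iff] at hrs
  obtain ⟨a, ha, s, hs, has⟩ := exists_eq_smul_of_mem_maximalIdeal (hm a' (by simp))
  obtain ⟨b, hb, t, ht, hbt⟩ := exists_eq_smul_of_mem_maximalIdeal (hm b' (by simp))
  obtain ⟨m, hma⟩ := (hP a).mp ha
  obtain ⟨m', hmb⟩ := (hP b).mp hb
  -- Here m and m' represent a(cx) and b(cx). Regularity of b' modulo a' makes m divisible by a
  -- locally at P, so a multiple of cx by an element outside P lies in the range of g, which is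
  -- absurd.
  have hab : b • m = a • m' := hg (by rw [map_smul, map_smul, hma, hmb, smul_comm])
  -- If a = 0, regularity of a' forces M = 0; then P, which is nonzero, kills cx in the torsion-free
  -- V, so cx = 0 and 1 ∈ P.
  have ha0 : a ≠ 0 := by
    rintro rfl
    have hM0 : ∀ z : M, z = 0 := fun z => by
      have h3 : a' • LocalizedModule.mk (s • z) (1 : P.primeCompl) = a' • 0 := by
        rw [← LocalizedModule.smul'_mk, ← algebraMap_smul (Localization.AtPrime P) s, smul_smul,
          mul_comm, has]
        simp
      obtain ⟨v, hv, hvs⟩ := eq_zero_of_localizedModule_mk (hrs.1 h3)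
      refine hg (smul_right_injective V (r := v * s) (fun h0 => ?_) ?_)
      · exact (hPp.mem_or_mem (h0 ▸ P.zero_mem : v * s ∈ P)).elim hv hs
      · simp only
        rw [← map_smul, ← map_smul, mul_smul, hvs, smul_zero]
    have hPbot : P ≠ ⊥ := by
      rintro rfl
      rw [Ideal.height_bot] at h2
      exact absurd h2 (by decide)
    obtain ⟨d, hd, hd0⟩ := Submodule.exists_mem_ne_zero_of_ne_bot hPbot
    obtain ⟨z, hz⟩ := (hP d).mp hd
    have hcx : c • x = 0 := by
      refine (smul_eq_zero_iff_right hd0).mp ?_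
      rw [← hz, hM0 z, map_zero]
    exact hPp.ne_top ((Ideal.eq_top_iff_one P).mpr ((hP 1).mpr (by simp [hcx])))
  have hma' : ∃ w : LocalizedModule P.primeCompl M,
      LocalizedModule.mk (t • m) (1 : P.primeCompl) = a' • w := by
    have := (isSMulRegular_quotient_iff_mem_of_smul_mem _ _).mp hrs.2.1
      (LocalizedModule.mk (t • m) (1 : P.primeCompl)) ?_
    · obtain ⟨w, -, hw⟩ := (Submodule.mem_smul_pointwise_iff_exists _ _ _).mp this
      exact ⟨w, hw.symm⟩
    · rw [← LocalizedModule.smul'_mk, ← algebraMap_smul (Localization.AtPrime P) t, smul_smul,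
        mul_comm, hbt, algebraMap_smul, LocalizedModule.smul'_mk, hab,
        ← LocalizedModule.smul'_mk, ← algebraMap_smul (Localization.AtPrime P) a, ← has, mul_comm,
        mul_smul]
      exact Submodule.smul_mem_pointwise_smul _ _ _ trivial
  obtain ⟨w, hw⟩ := hma'
  obtain ⟨v, hv, m'', hvm⟩ := exists_notMem_smul_eq_of_localizedModule hs has w hw
  have : v * t ∈ P := by
    rw [hP]
    refine ⟨m'', ?_⟩
    apply smul_right_injective V ha0
    change a • g m'' = a • (v * t) • c • x
    rw [← map_smul, ← hvm, map_smul, map_smul, hma, smul_smul, smul_comm]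
  exact (hPp.mem_or_mem this).elim hv ht

end LocalizationMCM


/-! ### Classes of modules in `H(R)` -/

section Classes

variable {R : Type u} [CommRing R]

theorem H.cls_eq_add_of_exact {M₁ M₂ M₃ : FGModuleCat.{u} R} (f : M₁ →ₗ[R] M₂) (g : M₂ →ₗ[R] M₃)
    (hf : Function.Injective f) (hfg : Function.Exact f g) (hg : Function.Surjective g) :
    H.cls M₂ = H.cls M₁ + H.cls M₃ := by
  have h : G.cls M₂ = G.cls M₁ + G.cls M₃ := by
    rw [← sub_eq_zero, ← sub_sub]
    exact (QuotientAddGroup.eq_zero_iff _).mpr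
      (AddSubgroup.subset_closure ⟨M₁, M₂, M₃, f, g, hf, hfg, hg, rfl⟩)
  rw [H.cls, h]
  rfl

theorem H.cls_eq_zero {M : FGModuleCat.{u} R} (h : IsPseudoZero R M) : H.cls M = 0 :=
  (QuotientAddGroup.eq_zero_iff _).mpr (AddSubgroup.subset_closure ⟨M, h, rfl⟩)

theorem H.cls_eq_zero_of_subsingleton {M : FGModuleCat.{u} R} (h : Subsingleton M) :
    H.cls M = 0 := by
  refine H.cls_eq_zero fun p _ _ => ?_
  rw [LocalizedModule.subsingleton_iff]
  exact fun m => ⟨1, p.primeCompl.one_mem, Subsingleton.elim _ _⟩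

theorem H.cls_congr {M N : FGModuleCat.{u} R} (e : M ≃ₗ[R] N) : H.cls M = H.cls N := by
  have h := H.cls_eq_add_of_exact (M₃ := FGModuleCat.of R PUnit.{u + 1}) e.toLinearMap 0 e.injective
    ((LinearMap.exact_zero_iff_surjective _ _).mpr e.surjective) (fun _ => ⟨0, rfl⟩)
  rwa [H.cls_eq_zero_of_subsingleton (M := FGModuleCat.of R PUnit.{u + 1})
    (inferInstanceAs (Subsingleton PUnit)), add_zero, eq_comm] at h

theorem H.cls_pi (M : Type u) [AddCommGroup M] [Module R M] [Module.Finite R M] (n : ℕ) :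
    H.cls (FGModuleCat.of R (Fin n → M)) = n • H.cls (FGModuleCat.of R M) := by
  induction n with
  | zero =>
    rw [zero_nsmul]
    exact H.cls_eq_zero_of_subsingleton (inferInstanceAs (Subsingleton (Fin 0 → M)))
  | succ n ih =>
    let e : (Fin (n + 1) → M) ≃ₗ[R] M × (Fin n → M) := (Fin.consLinearEquiv R (fun _ => M)).symm
    rw [H.cls_congr (N := FGModuleCat.of R (M × (Fin n → M))) e,
      H.cls_eq_add_of_exact (M₁ := FGModuleCat.of R M) (M₃ := FGModuleCat.of R (Fin n → M))
        (LinearMap.inl R M (Fin n → M)) (LinearMap.snd R M (Fin n → M)) LinearMap.inl_injective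
        .inl_snd LinearMap.snd_surjective, ih, succ_nsmul']

end Classes

/-! ### Lengths at primes -/

section Length

variable {R : Type u} [CommRing R]

/-- The length of the localization of a module at a prime. -/
def lengthAt (p : Ideal R) [p.IsPrime] (M : Type u) [AddCommGroup M] [Module R M] : ℕ∞ :=
  Module.length (Localization.AtPrime p) (LocalizedModule p.primeCompl M)

variable (p : Ideal R) [p.IsPrime]
variable {M N P : Type u} [AddCommGroup M] [Module R M] [AddCommGroup N] [Module R N]
  [AddCommGroup P] [Module R P]

theorem lengthAt_eq_add_of_exact {f : M →ₗ[R] N} {g : N →ₗ[R] P} (hf : Function.Injective f)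
    (hfg : Function.Exact f g) (hg : Function.Surjective g) :
    lengthAt p N = lengthAt p M + lengthAt p P :=
  Module.length_eq_add_of_exact (LocalizedModule.map p.primeCompl f)
    (LocalizedModule.map p.primeCompl g) (LocalizedModule.map_injective _ f hf)
    (LocalizedModule.map_surjective _ g hg) (LocalizedModule.map_exact _ f g hfg)

theorem lengthAt_eq_zero_iff : lengthAt p M = 0 ↔ ∀ m : M, ∃ t ∉ p, t • m = 0 := by
  rw [lengthAt, Module.length_eq_zero_iff, LocalizedModule.subsingleton_iff]
  rfl

theorem lengthAt_congr (e : M ≃ₗ[R] N) : lengthAt p M = lengthAt p N := by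
  have h := lengthAt_eq_add_of_exact p (P := PUnit.{u + 1}) (f := e.toLinearMap) (g := 0) e.injective
    ((LinearMap.exact_zero_iff_surjective _ _).mpr e.surjective) (fun _ => ⟨0, rfl⟩)
  rw [(lengthAt_eq_zero_iff p (M := PUnit.{u + 1})).mpr
    fun m => ⟨1, fun h => Ideal.IsPrime.ne_top ‹_› ((Ideal.eq_top_iff_one p).mpr h), rfl⟩,
    add_zero] at h
  exact h.symm

/-- The localization of a quotient, computed in any localization of the ambient module. -/
theorem lengthAt_quotient {N' : Type*} [AddCommGroup N'] [Module R N']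
    [Module (Localization.AtPrime p) N'] [IsScalarTower R (Localization.AtPrime p) N']
    (i : N →ₗ[R] N') [IsLocalizedModule p.primeCompl i] (L : Submodule R N) :
    lengthAt p (N ⧸ L) = Module.length (Localization.AtPrime p)
      (N' ⧸ L.localized' (Localization.AtPrime p) p.primeCompl i) :=
  ((IsLocalizedModule.linearEquiv p.primeCompl (LocalizedModule.mkLinearMap p.primeCompl (N ⧸ L))
    (L.toLocalizedQuotient' (Localization.AtPrime p) p.primeCompl i)).extendScalarsOfIsLocalization
      p.primeCompl (Localization.AtPrime p)).length_eq

theorem lengthAt_quotient_self : lengthAt p (R ⧸ p) = 1 := by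
  have h : p.localized' (Localization.AtPrime p) p.primeCompl
      (Algebra.linearMap R (Localization.AtPrime p)) =
      IsLocalRing.maximalIdeal (Localization.AtPrime p) := by
    rw [Submodule.localized'_eq_span, ← Localization.AtPrime.map_eq_maximalIdeal]
    rfl
  rw [lengthAt_quotient p (Algebra.linearMap R (Localization.AtPrime p)), h,
    Module.length_eq_one_iff, isSimpleModule_iff_isCoatom]
  exact (IsLocalRing.maximalIdeal.isMaximal _).out

/-- The length at a prime of a cokernel, computed in any localizations of source and target. -/
theorem lengthAt_quotient_range {M' N' : Type*} [AddCommGroup M'] [Module R M']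
    [Module (Localization.AtPrime p) M'] [IsScalarTower R (Localization.AtPrime p) M']
    [AddCommGroup N'] [Module R N']
    [Module (Localization.AtPrime p) N'] [IsScalarTower R (Localization.AtPrime p) N']
    (i : M →ₗ[R] M') [IsLocalizedModule p.primeCompl i]
    (j : N →ₗ[R] N') [IsLocalizedModule p.primeCompl j] {f : M →ₗ[R] N}
    {f' : M' →ₗ[Localization.AtPrime p] N'} (h : ∀ m, f' (i m) = j (f m)) :
    lengthAt p (N ⧸ LinearMap.range f) =
      Module.length (Localization.AtPrime p) (N' ⧸ LinearMap.range f') := by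
  rw [lengthAt_quotient p j]
  have hf' : f' = (IsLocalizedModule.map p.primeCompl i j f).extendScalarsOfIsLocalization
      p.primeCompl (Localization.AtPrime p) := by
    apply LinearMap.restrictScalars_injective R
    refine IsLocalizedModule.ext p.primeCompl i (IsLocalizedModule.map_units j) ?_
    ext m
    simp [h]
  rw [hf', LinearMap.localized'_range_eq_range_localizedMap (Localization.AtPrime p) p.primeCompl i]

/-! ### Colength as the order of a determinant -/

section Determinant

open Module

/-- Over a principal ideal domain, the colength of an endomorphism of a free module is the order
of its determinant. -/
theorem length_quotient_range_eq_ord_det {B : Type*} [CommRing B] [IsDomain B]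
    [IsPrincipalIdealRing B] {F : Type*} [AddCommGroup F] [Module B F] [Module.Free B F]
    [Module.Finite B F] (f : F →ₗ[B] F) (hf : LinearMap.det f ≠ 0) :
    Module.length B (F ⧸ LinearMap.range f) = Ring.ord B (LinearMap.det f) := by
  classical
  have hinj : Function.Injective f := by
    rw [← LinearMap.ker_eq_bot]
    by_contra h
    exact hf (LinearMap.det_eq_zero_iff_ker_ne_bot.mpr h)
  let b := Module.Free.chooseBasis B F
  have hrank : Module.finrank B (LinearMap.range f) = Module.finrank B F :=
    LinearMap.finrank_range_of_inj hinj
  let a := Submodule.smithNormalFormCoeffs b hrank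
  let b' := Submodule.smithNormalFormTopBasis b hrank
  let ab := Submodule.smithNormalFormBotBasis b hrank
  -- By Smith normal form, f composed with an automorphism of F is the diagonal map with entries a
  -- i.
  have hdet : Associated (LinearMap.det f) (∏ i, a i) := by
    rw [← Matrix.det_diagonal, ← LinearMap.det_toLin b']
    refine (LinearMap.associated_det_of_eq_comp
      ((b'.equiv ab (Equiv.refl _)).trans (LinearEquiv.ofInjective f hinj).symm) _ _ fun x => ?_).symm
    have h1 : ∀ z : LinearMap.range f, f ((LinearEquiv.ofInjective f hinj).symm z) = z := fun z =>
      congr_arg Subtype.val ((LinearEquiv.ofInjective f hinj).apply_symm_apply z)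
    rw [LinearEquiv.trans_apply, h1]
    have h2 : Matrix.toLin b' b' (Matrix.diagonal a) =
        (LinearMap.range f).subtype ∘ₗ (b'.equiv ab (Equiv.refl _)).toLinearMap := by
      refine b'.ext fun i => ?_
      simp [Matrix.toLin_apply, Finsupp.single_eq_pi_single,
        Pi.single_apply, ab, a, b']
    rw [h2]
    rfl
  -- The cokernel is the product of the B/(a i), whose lengths are by definition the orders of the a
  -- i.
  rw [(Submodule.quotientEquivPiSpan (LinearMap.range f) b hrank).length_eq,
    Module.length_pi_of_fintype, Ring.ord_eq_of_associated hdet]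
  have key : ∀ s : Finset (Module.Free.ChooseBasisIndex B F),
      Ring.ord B (∏ i ∈ s, a i) = ∑ i ∈ s, Ring.ord B (a i) := by
    intro s
    induction s using Finset.induction_on with
    | empty => simp
    | insert i s hi ih =>
      rw [Finset.prod_insert hi, Finset.sum_insert hi, Ring.ord_mul B, ih]
      exact mem_nonZeroDivisors_of_ne_zero
        (Finset.prod_ne_zero_iff.mpr fun i _ => Submodule.smithNormalFormCoeffs_ne_zero b hrank i)
  rw [key]
  rfl

theorem lengthAt_quotient_range_eq_ord_det [IsDomain R]
    [IsDiscreteValuationRing (Localization.AtPrime p)] [Module.Free R M] [Module.Finite R M]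
    (f : M →ₗ[R] M) (hf : LinearMap.det f ≠ 0) :
    lengthAt p (M ⧸ LinearMap.range f) =
      Ring.ord (Localization.AtPrime p) (algebraMap R _ (LinearMap.det f)) := by
  classical
  let b := Module.Free.chooseBasis R M
  let i := LocalizedModule.mkLinearMap p.primeCompl M
  let b' := b.ofIsLocalizedModule (Localization.AtPrime p) p.primeCompl i
  let f' := LocalizedModule.map p.primeCompl f
  have hff : ∀ m, f' (i m) = i (f m) := fun m => by simp [f', i]
  have hdet : LinearMap.det f' = algebraMap R _ (LinearMap.det f) := by
    rw [← LinearMap.det_toMatrix b', ← LinearMap.det_toMatrix b, RingHom.map_det]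
    congr 1
    ext k l
    rw [LinearMap.toMatrix_apply,
      b.ofIsLocalizedModule_apply (Localization.AtPrime p) p.primeCompl i, hff]
    simp [b', LinearMap.toMatrix_apply]
  have : Module.Free (Localization.AtPrime p) (LocalizedModule p.primeCompl M) := .of_basis b'
  rw [lengthAt_quotient_range p i i hff, length_quotient_range_eq_ord_det f', hdet]
  rw [hdet]
  exact (map_ne_zero_iff _ (IsLocalization.injective (Localization.AtPrime p)
    p.primeCompl_le_nonZeroDivisors)).mpr hf

end Determinant

/-- The height one primes of a ring. -/
abbrev HeightOne (R : Type u) [CommRing R] : Type u := {p : Ideal R // p.IsPrime ∧ p.height = 1}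

instance (p : HeightOne R) : p.1.IsPrime := p.2.1

variable (R M) in
/-- A module annihilated by a nonzero element. -/
def IsBoundedTorsion : Prop := ∃ a : R, a ≠ 0 ∧ ∀ x : M, a • x = 0

theorem IsBoundedTorsion.of_injective {f : M →ₗ[R] N} (hf : Function.Injective f)
    (h : IsBoundedTorsion R N) : IsBoundedTorsion R M := by
  obtain ⟨a, ha, h⟩ := h
  exact ⟨a, ha, fun x => hf (by rw [map_smul, h, map_zero])⟩

theorem IsBoundedTorsion.of_surjective {f : M →ₗ[R] N} (hf : Function.Surjective f)
    (h : IsBoundedTorsion R M) : IsBoundedTorsion R N := by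
  obtain ⟨a, ha, h⟩ := h
  refine ⟨a, ha, fun x => ?_⟩
  obtain ⟨y, rfl⟩ := hf x
  rw [← map_smul, h, map_zero]

open Classical in
/-- In `H(R)`, the class of a torsion module is determined by its lengths at height one primes. -/
theorem exists_H_cls_eq_sum [IsDomain R] [IsNoetherianRing R] [Module.Finite R M]
    (h : IsBoundedTorsion R M) :
    ∃ L : HeightOne R →₀ ℕ, (∀ p : HeightOne R, lengthAt p.1 M = L p) ∧
      H.cls (FGModuleCat.of R M) = L.sum fun p n => n • H.cls (FGModuleCat.of R (R ⧸ p.1)) := by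
  -- Both sides are additive, so prime filtration leaves R/q, with q ≠ 0 by torsion. For q of height
  -- one it has length one at q and zero at other height one primes; for larger height it is
  -- pseudo-zero.
  induction ‹Module.Finite R M› using
    IsNoetherianRing.induction_on_isQuotientEquivQuotientPrime R with
  | subsingleton N =>
    refine ⟨0, fun p => ?_, ?_⟩
    · rw [Finsupp.zero_apply, Nat.cast_zero, lengthAt_eq_zero_iff]
      exact fun m => ⟨1, fun h => p.2.1.ne_top ((Ideal.eq_top_iff_one _).mpr h),
        Subsingleton.elim _ _⟩
    · rw [Finsupp.sum_zero_index]
      exact H.cls_eq_zero_of_subsingleton ‹_›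
  | quotient N q f =>
    have hq : q.1 ≠ ⊥ := by
      obtain ⟨a, ha, h⟩ := h
      intro hq
      have h1 := h (f.symm 1)
      rw [← map_smul, f.symm.map_eq_zero_iff, Algebra.smul_def, mul_one] at h1
      have h2 : a ∈ q.1 := Ideal.Quotient.eq_zero_iff_mem.mp h1
      rw [hq] at h2
      exact ha h2
    have hoff (p : Ideal R) [p.IsPrime] (hp : ¬ q.1 ≤ p) : lengthAt p N = 0 := by
      rw [lengthAt_congr p f, lengthAt_eq_zero_iff]
      obtain ⟨t, htq, htp⟩ := SetLike.not_le_iff_exists.mp hp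
      refine fun m => ⟨t, htp, ?_⟩
      rw [Algebra.smul_def, Ideal.Quotient.algebraMap_eq, Ideal.Quotient.eq_zero_iff_mem.mpr htq,
        zero_mul]
    have heq (p : Ideal R) [p.IsPrime] (hp1 : p.height ≤ 1) (hp : q.1 ≤ p) : q.1 = p := by
      by_contra hne
      have h1 := (Ideal.height_add_one_le_of_lt_of_isPrime (lt_of_le_of_ne hp hne)).trans hp1
      refine hq (Ideal.height_eq_zero_iff_eq_bot.mp ?_)
      by_contra h0
      have h3 : (1 : ℕ∞) + 1 ≤ 1 :=
        (by gcongr; exact Order.one_le_iff_ne_zero.mpr h0 : _ ≤ q.1.height + 1).trans h1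
      exact absurd h3 (by decide)
    by_cases h1 : q.1.height = 1
    · let q' : HeightOne R := ⟨q.1, q.2, h1⟩
      refine ⟨Finsupp.single q' 1, fun p => ?_, ?_⟩
      · rw [Finsupp.single_apply]
        split_ifs with hp
        · rw [← hp, lengthAt_congr q'.1 f, lengthAt_quotient_self, Nat.cast_one]
        · rw [hoff p.1 fun hle => hp (Subtype.ext (heq p.1 p.2.2.le hle)), Nat.cast_zero]
      · rw [Finsupp.sum_single_index
          (h := fun (p : HeightOne R) n => n • H.cls (FGModuleCat.of R (R ⧸ p.1))) (zero_nsmul _),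
          one_nsmul]
        exact H.cls_congr (M := FGModuleCat.of R N) (N := FGModuleCat.of R (R ⧸ q.1)) f
    · refine ⟨0, fun p => ?_, ?_⟩
      · rw [hoff p.1 fun hle => h1 (heq p.1 p.2.2.le hle ▸ p.2.2), Finsupp.zero_apply, Nat.cast_zero]
      · rw [Finsupp.sum_zero_index]
        refine H.cls_eq_zero fun p _ hp => ?_
        refine Module.length_eq_zero_iff.mp (hoff p fun hle => ?_)
        have hqp := heq p hp hle
        rw [← hqp] at hp
        exact h1 (le_antisymm hp (Order.one_le_iff_ne_zero.mpr
          fun h0 => hq (Ideal.height_eq_zero_iff_eq_bot.mp h0)))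
  | exact N₁ N₂ N₃ f g hf hg hfg h₁ h₃ =>
    obtain ⟨L₁, hL₁, hc₁⟩ := h₁ (h.of_injective hf)
    obtain ⟨L₃, hL₃, hc₃⟩ := h₃ (h.of_surjective hg)
    refine ⟨L₁ + L₃, fun p => ?_, ?_⟩
    · rw [lengthAt_eq_add_of_exact p.1 hf hfg hg, hL₁, hL₃, Finsupp.add_apply, Nat.cast_add]
    · rw [Finsupp.sum_add_index'
        (h := fun (p : HeightOne R) n => n • H.cls (FGModuleCat.of R (R ⧸ p.1)))
        (fun _ => zero_nsmul _) (fun _ _ _ => add_nsmul _ _ _), ← hc₁,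
        ← hc₃]
      exact H.cls_eq_add_of_exact (M₁ := FGModuleCat.of R N₁) (M₂ := FGModuleCat.of R N₂)
        (M₃ := FGModuleCat.of R N₃) f g hf hfg hg

theorem lengthAt_ne_top [IsDomain R] [IsNoetherianRing R] [Module.Finite R M]
    (h : IsBoundedTorsion R M) (p : HeightOne R) : lengthAt p.1 M ≠ ⊤ := by
  obtain ⟨L, hL, -⟩ := exists_H_cls_eq_sum h
  simp [hL]

theorem H.cls_eq_of_lengthAt_eq [IsDomain R] [IsNoetherianRing R] [Module.Finite R M]
    [Module.Finite R N] (hM : IsBoundedTorsion R M) (hN : IsBoundedTorsion R N)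
    (h : ∀ p : HeightOne R, lengthAt p.1 M = lengthAt p.1 N) :
    H.cls (FGModuleCat.of R M) = H.cls (FGModuleCat.of R N) := by
  obtain ⟨L, hL, hc⟩ := exists_H_cls_eq_sum hM
  obtain ⟨L', hL', hc'⟩ := exists_H_cls_eq_sum hN
  have : L = L' := by
    ext p
    have := h p
    rw [hL, hL'] at this
    exact_mod_cast this
  rw [hc, hc', this]

end Length


/-! ### Free submodules with torsion cokernel -/

section Lattice

variable {R : Type u} [CommRing R]
variable {M N P : Type u} [AddCommGroup M] [Module R M] [AddCommGroup N] [Module R N]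
  [AddCommGroup P] [Module R P]

/-- An injective linear map whose cokernel is annihilated by a nonzero element. -/
structure IsLattice (v : M →ₗ[R] N) : Prop where
  injective : Function.Injective v
  exists_smul_mem : ∃ a : R, a ≠ 0 ∧ ∀ m, a • m ∈ LinearMap.range v

theorem IsLattice.isBoundedTorsion {v : M →ₗ[R] N} (hv : IsLattice v) :
    IsBoundedTorsion R (N ⧸ LinearMap.range v) := by
  obtain ⟨a, ha, h⟩ := hv.exists_smul_mem
  refine ⟨a, ha, fun x => ?_⟩
  obtain ⟨x, rfl⟩ := Submodule.Quotient.mk_surjective _ x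
  rw [← Submodule.Quotient.mk_smul, Submodule.Quotient.mk_eq_zero]
  exact h x

theorem IsLattice.comp [IsDomain R] {v : M →ₗ[R] N} {w : N →ₗ[R] P} (hw : IsLattice w)
    (hv : IsLattice v) : IsLattice (w ∘ₗ v) := by
  obtain ⟨a, ha, h⟩ := hv.exists_smul_mem
  obtain ⟨b, hb, h'⟩ := hw.exists_smul_mem
  refine ⟨hw.injective.comp hv.injective, a * b, mul_ne_zero ha hb, fun m => ?_⟩
  obtain ⟨y, hy⟩ := h' m
  obtain ⟨x, hx⟩ := h y
  exact ⟨x, by rw [LinearMap.comp_apply, hx, map_smul, hy, mul_smul]⟩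

theorem IsLattice.lengthAt_ne_top [IsDomain R] [IsNoetherianRing R] [Module.Finite R N]
    {v : M →ₗ[R] N} (hv : IsLattice v)
    (p : HeightOne R) : lengthAt p.1 (N ⧸ LinearMap.range v) ≠ ⊤ :=
  CMCone.lengthAt_ne_top hv.isBoundedTorsion p

theorem isLattice_smul_id [IsDomain R] [Module.IsTorsionFree R M] {a : R} (ha : a ≠ 0) :
    IsLattice (a • LinearMap.id : M →ₗ[R] M) :=
  ⟨smul_right_injective M ha, a, ha, fun m => ⟨m, rfl⟩⟩

/-- Length is additive on 0 → N/v(M) → P/wv(M) → P/w(N) → 0. -/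
theorem lengthAt_quotient_range_comp (p : Ideal R) [p.IsPrime] (v : M →ₗ[R] N) {w : N →ₗ[R] P}
    (hw : Function.Injective w) :
    lengthAt p (P ⧸ LinearMap.range (w ∘ₗ v)) =
      lengthAt p (N ⧸ LinearMap.range v) + lengthAt p (P ⧸ LinearMap.range w) := by
  have hle : LinearMap.range (w ∘ₗ v) ≤ LinearMap.range w := LinearMap.range_comp_le_range v w
  have hcomap : LinearMap.range v = (LinearMap.range (w ∘ₗ v)).comap w := by
    rw [LinearMap.range_comp, Submodule.comap_map_eq_of_injective hw]
  refine lengthAt_eq_add_of_exact p (f := Submodule.mapQ _ _ w hcomap.le)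
    (g := Submodule.factor hle) ?_ ?_ ?_
  · rw [← LinearMap.ker_eq_bot, Submodule.ker_mapQ, ← hcomap, Submodule.mkQ_map_self]
  · intro x
    obtain ⟨x, rfl⟩ := Submodule.Quotient.mk_surjective _ x
    constructor
    · intro h
      have h' : x ∈ LinearMap.range w := by
        rw [← Submodule.Quotient.mk_eq_zero]
        exact h
      obtain ⟨y, rfl⟩ := h'
      exact ⟨Submodule.Quotient.mk y, rfl⟩
    · rintro ⟨y, hy⟩
      obtain ⟨y, rfl⟩ := Submodule.Quotient.mk_surjective _ y
      rw [← hy]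
      exact (Submodule.Quotient.mk_eq_zero _).mpr ⟨y, rfl⟩
  · exact Submodule.factor_surjective hle

theorem isBoundedTorsion_of_finrank_eq_zero [IsDomain R] [Module.Finite R M]
    (h : Module.finrank R M = 0) : IsBoundedTorsion R M := by
  rw [Module.finrank_eq_zero_iff] at h
  have ht : Module.IsTorsion R M := fun {x} => by
    obtain ⟨a, ha, hx⟩ := h x
    exact ⟨⟨a, mem_nonZeroDivisors_of_ne_zero ha⟩, hx⟩
  obtain ⟨a, ha, ha'⟩ := Submodule.annihilator_top_inter_nonZeroDivisors ht
  exact ⟨a, nonZeroDivisors.ne_zero ha', fun x => (Submodule.mem_annihilator.mp ha) x trivial⟩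

theorem IsLattice.finrank_eq [IsDomain R] [Module.Finite R N]
    {v : M →ₗ[R] N} (hv : IsLattice v) :
    Module.finrank R M = Module.finrank R N := by
  have h1 := Submodule.finrank_quotient_add_finrank (LinearMap.range v)
  have h2 : Module.finrank R (N ⧸ LinearMap.range v) = 0 := by
    rw [Module.finrank_eq_zero_iff]
    obtain ⟨a, ha, h⟩ := hv.isBoundedTorsion
    exact fun x => ⟨a, ha, h x⟩
  rw [LinearMap.finrank_range_of_inj hv.injective] at h1
  omega

variable (R M) in
-- A maximal linearly independent family spans a free submodule whose cokernel has rank zero; finite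
-- generation provides a single annihilator.
theorem exists_isLattice [IsDomain R] [Module.Finite R M] :
    ∃ v : (Fin (Module.finrank R M) → R) →ₗ[R] M, IsLattice v := by
  obtain ⟨f, hf⟩ := exists_linearIndependent_of_le_finrank (R := R) (M := M) le_rfl
  let v := Fintype.linearCombination R f
  have hinj : Function.Injective v := hf.fintypeLinearCombination_injective
  refine ⟨v, hinj, ?_⟩
  have h1 := Submodule.finrank_quotient_add_finrank (LinearMap.range v)
  rw [LinearMap.finrank_range_of_inj hinj, Module.finrank_fin_fun] at h1
  obtain ⟨a, ha, h⟩ := isBoundedTorsion_of_finrank_eq_zero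
    (show Module.finrank R (M ⧸ LinearMap.range v) = 0 by omega)
  refine ⟨a, ha, fun m => ?_⟩
  rw [← Submodule.Quotient.mk_eq_zero, Submodule.Quotient.mk_smul]
  exact h _

/-- A linear map into the target of an injective map factors if its values lie in the range. -/
theorem exists_comp_eq_of_forall_mem_range {v : M →ₗ[R] N} (hv : Function.Injective v)
    (f : P →ₗ[R] N) (hf : ∀ x, f x ∈ LinearMap.range v) : ∃ g : P →ₗ[R] M, v ∘ₗ g = f := by
  refine ⟨(LinearEquiv.ofInjective v hv).symm.toLinearMap ∘ₗ f.codRestrict _ hf, ?_⟩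
  ext x
  exact congr_arg Subtype.val ((LinearEquiv.ofInjective v hv).apply_symm_apply ⟨f x, hf x⟩)

/-- The colengths of two free lattices differ by a principal divisor. -/
theorem IsLattice.exists_ord_add_lengthAt_eq [IsDomain R] [IsNoetherianRing R]
    [IsIntegrallyClosed R] [Module.Finite R M] {F F' : Type u} [AddCommGroup F] [Module R F] [AddCommGroup F']
    [Module R F'] [Module.Free R F] [Module.Finite R F] [Module.Free R F'] [Module.Finite R F']
    {v : F →ₗ[R] M} {v' : F' →ₗ[R] M} (hv : IsLattice v) (hv' : IsLattice v') :
    ∃ a b : R, a ≠ 0 ∧ b ≠ 0 ∧ ∀ p : HeightOne R,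
      Ring.ord (Localization.AtPrime p.1) (algebraMap R _ a) +
          lengthAt p.1 (M ⧸ LinearMap.range v) =
        Ring.ord (Localization.AtPrime p.1) (algebraMap R _ b) +
          lengthAt p.1 (M ⧸ LinearMap.range v') := by
  obtain ⟨c, hc, h⟩ := hv.exists_smul_mem
  let e : F ≃ₗ[R] F' := LinearEquiv.ofFinrankEq _ _ (hv.finrank_eq.trans hv'.finrank_eq.symm)
  -- Multiplication by c moves v' ∘ e into the range of v, giving an endomorphism A of F with v ∘ A
  -- = w. Computing the colength of w through each factorization yields a = det A and b = det(c ·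
  -- id).
  let w : F →ₗ[R] M := (v' ∘ₗ e.toLinearMap) ∘ₗ (c • LinearMap.id)
  have hwinj : Function.Injective w :=
    (hv'.injective.comp e.injective).comp (smul_right_injective F hc)
  obtain ⟨A, hA⟩ := exists_comp_eq_of_forall_mem_range hv.injective w fun x => by
    simpa [w] using h (v' (e x))
  have hAinj : Function.Injective A := by
    rw [← hA] at hwinj
    exact Function.Injective.of_comp hwinj
  have hAdet : LinearMap.det A ≠ 0 := by
    intro h0
    exact LinearMap.det_eq_zero_iff_ker_ne_bot.mp h0 (LinearMap.ker_eq_bot.mpr hAinj)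
  have hcdet : LinearMap.det (c • LinearMap.id : F →ₗ[R] F) ≠ 0 := by
    rw [LinearMap.det_smul, LinearMap.det_id, mul_one]
    exact pow_ne_zero _ hc
  refine ⟨_, _, hAdet, hcdet, fun p => ?_⟩
  have := isDiscreteValuationRing_atPrime p.1 p.2.2
  rw [← lengthAt_quotient_range_eq_ord_det p.1 A hAdet,
    ← lengthAt_quotient_range_eq_ord_det p.1 _ hcdet,
    ← lengthAt_quotient_range_comp p.1 _ hv.injective, hA,
    lengthAt_quotient_range_comp p.1 _ (w := v' ∘ₗ e.toLinearMap)
      (hv'.injective.comp e.injective), LinearMap.range_comp_of_range_eq_top v' e.range]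

end Lattice

/-! ### The divisor class of a module -/

section DivisorClass

variable (R : Type u) [CommRing R]

variable {R} in
/-- The divisor of a nonzero element. -/
def divisorOf (a : R) : HeightOne R → ℤ :=
  fun p => ((Ring.ord (Localization.AtPrime p.1) (algebraMap R _ a)).toNat : ℤ)

variable [IsDomain R] [IsNoetherianRing R] [IsIntegrallyClosed R]

variable {R} in
theorem ord_algebraMap_ne_top {a : R} (ha : a ≠ 0) (p : HeightOne R) :
    Ring.ord (Localization.AtPrime p.1) (algebraMap R _ a) ≠ ⊤ := by
  have := isDiscreteValuationRing_atPrime p.1 p.2.2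
  exact Ring.ord_ne_top (mem_nonZeroDivisors_of_ne_zero
    ((map_ne_zero_iff _ (IsLocalization.injective (Localization.AtPrime p.1)
      p.1.primeCompl_le_nonZeroDivisors)).mpr ha))

variable {R} in
theorem divisorOf_mul {a b : R} (ha : a ≠ 0) (hb : b ≠ 0) :
    divisorOf (a * b) = divisorOf a + divisorOf b := by
  ext p
  have hb' : algebraMap R (Localization.AtPrime p.1) b ≠ 0 :=
    (map_ne_zero_iff _ (IsLocalization.injective (Localization.AtPrime p.1)
      p.1.primeCompl_le_nonZeroDivisors)).mpr hb
  simp only [divisorOf, Pi.add_apply]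
  rw [map_mul, Ring.ord_mul _ (mem_nonZeroDivisors_of_ne_zero hb'),
    ENat.toNat_add (ord_algebraMap_ne_top ha p) (ord_algebraMap_ne_top hb p), Nat.cast_add]

/-- The group of principal divisors. -/
def principalDivisors : AddSubgroup (HeightOne R → ℤ) where
  carrier := {x | ∃ a b : R, a ≠ 0 ∧ b ≠ 0 ∧ x = divisorOf a - divisorOf b}
  zero_mem' := ⟨1, 1, one_ne_zero, one_ne_zero, by simp⟩
  add_mem' := by
    rintro _ _ ⟨a, b, ha, hb, rfl⟩ ⟨c, d, hc, hd, rfl⟩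
    refine ⟨a * c, b * d, mul_ne_zero ha hc, mul_ne_zero hb hd, ?_⟩
    rw [divisorOf_mul ha hc, divisorOf_mul hb hd]
    abel
  neg_mem' := by
    rintro _ ⟨a, b, ha, hb, rfl⟩
    exact ⟨b, a, hb, ha, by abel⟩

/-- The group of divisors modulo principal divisors. -/
abbrev DivisorClass : Type u := (HeightOne R → ℤ) ⧸ principalDivisors R

variable {R}
variable {M N P : Type u} [AddCommGroup M] [Module R M] [AddCommGroup N] [Module R N]
  [AddCommGroup P] [Module R P]

/-- The divisor of the cokernel of a map. -/
def colengthDivisor (v : M →ₗ[R] N) : HeightOne R → ℤ :=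
  fun p => ((lengthAt p.1 (N ⧸ LinearMap.range v)).toNat : ℤ)

variable (R M) in
/-- The divisor class of a finitely generated module. -/
def divisorClass [Module.Finite R M] : DivisorClass R :=
  QuotientAddGroup.mk (colengthDivisor (exists_isLattice R M).choose)

/-- Independence of `divisorClass` from the chosen lattice. All lengths involved are finite, so
`toNat` loses nothing. -/
theorem IsLattice.mk_colengthDivisor [Module.Finite R M] {F : Type u} [AddCommGroup F] [Module R F]
    [Module.Free R F] [Module.Finite R F] {v : F →ₗ[R] M} (hv : IsLattice v) :
    (QuotientAddGroup.mk (colengthDivisor v) : DivisorClass R) = divisorClass R M := by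
  have hv' := (exists_isLattice R M).choose_spec
  obtain ⟨a, b, ha, hb, h⟩ := hv.exists_ord_add_lengthAt_eq hv'
  refine (QuotientAddGroup.eq).mpr ⟨a, b, ha, hb, ?_⟩
  ext p
  have := congr_arg ENat.toNat (h p)
  rw [ENat.toNat_add (ord_algebraMap_ne_top ha p) (hv.lengthAt_ne_top p),
    ENat.toNat_add (ord_algebraMap_ne_top hb p) (hv'.lengthAt_ne_top p)] at this
  simp only [colengthDivisor, divisorOf, Pi.add_apply, Pi.neg_apply, Pi.sub_apply]
  omega

/-- Horseshoe argument: a lattice in P lifts through g and, with one in M, forms a lattice t in N.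
The three cokernels form a short exact sequence. -/
theorem divisorClass_eq_add_of_exact [Module.Finite R M] [Module.Finite R N] [Module.Finite R P]
    {f : M →ₗ[R] N} {g : N →ₗ[R] P} (hf : Function.Injective f) (hfg : Function.Exact f g)
    (hg : Function.Surjective g) :
    divisorClass R N = divisorClass R M + divisorClass R P := by
  obtain ⟨v, hv⟩ := exists_isLattice R M
  obtain ⟨w, hw⟩ := exists_isLattice R P
  obtain ⟨s, hs⟩ := Module.projective_lifting_property g w hg
  have hs' : ∀ z, g (s z) = w z := LinearMap.congr_fun hs
  have hgf : ∀ m, g (f m) = 0 := hfg.apply_apply_eq_zero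
  let t : ((Fin (Module.finrank R M) → R) × (Fin (Module.finrank R P) → R)) →ₗ[R] N :=
    (f ∘ₗ v).coprod s
  have ht_apply : ∀ x z, t (x, z) = f (v x) + s z := fun x z => rfl
  have ht : IsLattice t := by
    constructor
    · rw [injective_iff_map_eq_zero]
      rintro ⟨x, z⟩ h
      rw [ht_apply] at h
      have hz : z = 0 := by
        apply hw.injective
        rw [map_zero, ← hs', ← map_zero g, ← h, map_add, hgf, zero_add]
      subst hz
      rw [map_zero, add_zero] at h
      have hx : x = 0 := hv.injective (hf (by rw [h, map_zero, map_zero]))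
      rw [hx]
      rfl
    · obtain ⟨a, ha, hav⟩ := hv.exists_smul_mem
      obtain ⟨b, hb, hbw⟩ := hw.exists_smul_mem
      refine ⟨a * b, mul_ne_zero ha hb, fun n => ?_⟩
      obtain ⟨z, hz⟩ := hbw (g n)
      have h1 : g (b • n - s z) = 0 := by rw [map_sub, map_smul, hs', hz, sub_self]
      obtain ⟨m, hm⟩ := (hfg _).mp h1
      obtain ⟨x, hx⟩ := hav m
      refine ⟨(x, a • z), ?_⟩
      rw [ht_apply, hx, map_smul, hm, smul_sub, map_smul, mul_smul]
      abel
  have hft : LinearMap.range v ≤ (LinearMap.range t).comap f := by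
    rintro _ ⟨x, rfl⟩
    exact ⟨(x, 0), by rw [ht_apply, map_zero, add_zero]⟩
  have hgt : LinearMap.range t ≤ (LinearMap.range w).comap g := by
    rintro _ ⟨⟨x, z⟩, rfl⟩
    exact ⟨z, by rw [ht_apply, map_add, hgf, zero_add, hs']⟩
  have hadd (p : HeightOne R) : lengthAt p.1 (N ⧸ LinearMap.range t) =
      lengthAt p.1 (M ⧸ LinearMap.range v) + lengthAt p.1 (P ⧸ LinearMap.range w) := by
    refine lengthAt_eq_add_of_exact p.1 (f := Submodule.mapQ _ _ f hft)
      (g := Submodule.mapQ _ _ g hgt) ?_ ?_ ?_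
    · rw [injective_iff_map_eq_zero]
      intro x hx
      obtain ⟨m, rfl⟩ := Submodule.Quotient.mk_surjective _ x
      rw [Submodule.mapQ_apply, Submodule.Quotient.mk_eq_zero] at hx
      obtain ⟨⟨x, z⟩, hxz⟩ := hx
      rw [ht_apply] at hxz
      have hz : z = 0 := by
        apply hw.injective
        rw [map_zero, ← hs', ← hgf m, ← hxz, map_add, hgf, zero_add]
      rw [hz, map_zero, add_zero] at hxz
      exact (Submodule.Quotient.mk_eq_zero _).mpr ⟨x, hf hxz⟩
    · intro x
      obtain ⟨n, rfl⟩ := Submodule.Quotient.mk_surjective _ x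
      rw [Submodule.mapQ_apply, Submodule.Quotient.mk_eq_zero]
      constructor
      · rintro ⟨z, hz⟩
        have h1 : g (n - s z) = 0 := by rw [map_sub, hs', hz, sub_self]
        obtain ⟨m, hm⟩ := (hfg _).mp h1
        refine ⟨Submodule.Quotient.mk m, ?_⟩
        rw [Submodule.mapQ_apply, Submodule.Quotient.eq, hm]
        refine ⟨(0, -z), ?_⟩
        rw [ht_apply, map_zero, map_zero, map_neg]
        abel
      · rintro ⟨y, hy⟩
        obtain ⟨m, rfl⟩ := Submodule.Quotient.mk_surjective _ y
        rw [Submodule.mapQ_apply, Submodule.Quotient.eq] at hy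
        have h2 := hgt hy
        rw [Submodule.mem_comap, map_sub, hgf, zero_sub, neg_mem_iff] at h2
        exact h2
    · intro x
      obtain ⟨y, rfl⟩ := Submodule.Quotient.mk_surjective _ x
      obtain ⟨n, rfl⟩ := hg y
      exact ⟨Submodule.Quotient.mk n, rfl⟩
  rw [← ht.mk_colengthDivisor, ← hv.mk_colengthDivisor, ← hw.mk_colengthDivisor,
    ← QuotientAddGroup.mk_add]
  congr 1
  ext p
  simp only [colengthDivisor, Pi.add_apply]
  rw [hadd, ENat.toNat_add (hv.lengthAt_ne_top p) (hw.lengthAt_ne_top p), Nat.cast_add]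

theorem divisorClass_eq_zero_of_isPseudoZero [Module.Finite R M] (h : IsPseudoZero R M) :
    divisorClass R M = 0 := by
  rw [divisorClass, ← QuotientAddGroup.mk_zero]
  congr 1
  ext p
  have h0 : lengthAt p.1 (M ⧸ LinearMap.range (exists_isLattice R M).choose) = 0 := by
    have h1 : lengthAt p.1 M = 0 := Module.length_eq_zero_iff.mpr (h p.1 p.2.2.le)
    rw [lengthAt_eq_zero_iff] at h1 ⊢
    intro m
    obtain ⟨m, rfl⟩ := Submodule.Quotient.mk_surjective _ m
    obtain ⟨t, ht, htm⟩ := h1 m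
    exact ⟨t, ht, by rw [← Submodule.Quotient.mk_smul, htm, Submodule.Quotient.mk_zero]⟩
  simp [colengthDivisor, h0]

variable (R) in
/-- The divisor class as a homomorphism on `G(R)`. -/
def divisorClassG : G R →+ DivisorClass R :=
  QuotientAddGroup.lift _ (FreeAbelianGroup.lift fun M : FGModuleCat.{u} R => divisorClass R M) <| by
    rw [AddSubgroup.closure_le]
    rintro _ ⟨M₁, M₂, M₃, f, g, hf, hfg, hg, rfl⟩
    have := divisorClass_eq_add_of_exact hf hfg hg
    simp only [SetLike.mem_coe, AddMonoidHom.mem_ker, map_sub, FreeAbelianGroup.lift_apply_of, this]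
    abel

variable (R) in
/-- The divisor class as a homomorphism on `H(R)`. -/
def divisorClassH : H R →+ DivisorClass R :=
  QuotientAddGroup.lift _ (divisorClassG R) <| by
    rw [AddSubgroup.closure_le]
    rintro _ ⟨M, hM, rfl⟩
    have := divisorClass_eq_zero_of_isPseudoZero hM
    simp [G.cls, divisorClassG, this]

theorem divisorClassH_cls (M : FGModuleCat.{u} R) : divisorClassH R (H.cls M) = divisorClass R M :=
  FreeAbelianGroup.lift_apply_of (fun M : FGModuleCat.{u} R => divisorClass R M) M

end DivisorClass


/-! ### Maximal Cohen-Macaulay modules of rank one over a normal domain -/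

section RankOne

variable {R : Type u} [CommRing R] [IsDomain R]
variable {M N : Type u} [AddCommGroup M] [Module R M] [AddCommGroup N] [Module R N]

theorem exists_isLattice_of_finrank_eq_one [Module.Finite R M] (h : Module.finrank R M = 1) :
    ∃ v : R →ₗ[R] M, IsLattice v := by
  obtain ⟨v, hv⟩ := exists_isLattice R M
  let e : R ≃ₗ[R] (Fin (Module.finrank R M) → R) := LinearEquiv.ofFinrankEq _ _ (by simp [h])
  refine ⟨v ∘ₗ e.toLinearMap, hv.injective.comp e.injective, ?_⟩
  rw [LinearMap.range_comp_of_range_eq_top v e.range]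
  exact hv.exists_smul_mem

theorem lengthAt_quotient_range_smul_id [IsNoetherianRing R] [IsIntegrallyClosed R] {a : R}
    (ha : a ≠ 0) (p : HeightOne R) :
    lengthAt p.1 (R ⧸ LinearMap.range (a • LinearMap.id : R →ₗ[R] R)) =
      Ring.ord (Localization.AtPrime p.1) (algebraMap R _ a) := by
  have := isDiscreteValuationRing_atPrime p.1 p.2.2
  have hdet : LinearMap.det (a • LinearMap.id : R →ₗ[R] R) = a := by
    simp
  rw [lengthAt_quotient_range_eq_ord_det p.1 _ (by rwa [hdet]), hdet]

/-- Equality of classes means that the colength divisors differ by div(a) - div(b); rescaling v by a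
and w by b absorbs the difference. -/
theorem exists_isLattice_lengthAt_eq [IsNoetherianRing R] [IsIntegrallyClosed R]
    [Module.Finite R M] [Module.Finite R N] (hM : Module.finrank R M = 1)
    (hN : Module.finrank R N = 1) (h : divisorClass R M = divisorClass R N) :
    ∃ (v : R →ₗ[R] M) (w : R →ₗ[R] N), IsLattice v ∧ IsLattice w ∧ ∀ p : HeightOne R,
      lengthAt p.1 (M ⧸ LinearMap.range v) = lengthAt p.1 (N ⧸ LinearMap.range w) := by
  obtain ⟨v, hv⟩ := exists_isLattice_of_finrank_eq_one hM
  obtain ⟨w, hw⟩ := exists_isLattice_of_finrank_eq_one hN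
  rw [← hv.mk_colengthDivisor, ← hw.mk_colengthDivisor, QuotientAddGroup.eq] at h
  obtain ⟨a, b, ha, hb, h⟩ := h
  refine ⟨v ∘ₗ (a • LinearMap.id), w ∘ₗ (b • LinearMap.id), hv.comp (isLattice_smul_id ha),
    hw.comp (isLattice_smul_id hb), fun p => ?_⟩
  rw [lengthAt_quotient_range_comp _ _ hv.injective, lengthAt_quotient_range_comp _ _ hw.injective,
    lengthAt_quotient_range_smul_id ha, lengthAt_quotient_range_smul_id hb]
  have hp := congr_fun h p
  obtain ⟨i, hi⟩ := ENat.ne_top_iff_exists.mp (ord_algebraMap_ne_top ha p)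
  obtain ⟨j, hj⟩ := ENat.ne_top_iff_exists.mp (ord_algebraMap_ne_top hb p)
  obtain ⟨k, hk⟩ := ENat.ne_top_iff_exists.mp (hv.lengthAt_ne_top p)
  obtain ⟨l, hl⟩ := ENat.ne_top_iff_exists.mp (hw.lengthAt_ne_top p)
  simp only [colengthDivisor, divisorOf, Pi.add_apply, Pi.neg_apply, Pi.sub_apply, ← hi, ← hj, ← hk,
    ← hl, ENat.toNat_natCast] at hp
  rw [← hi, ← hj, ← hk, ← hl]
  have : i + k = j + l := by omega
  exact_mod_cast this

/-- The embedding is m ↦ g(m)/c, where v(g(m)) = cm. Its normalization on R lets two rank one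
modules be compared inside the same field. -/
theorem IsLattice.exists_injective_fractionRing [Module.IsTorsionFree R M] {v : R →ₗ[R] M}
    (hv : IsLattice v) : ∃ f : M →ₗ[R] FractionRing R, Function.Injective f ∧
      ∀ x, f (v x) = algebraMap R (FractionRing R) x := by
  obtain ⟨c, hc, h⟩ := hv.exists_smul_mem
  obtain ⟨g, hg⟩ := exists_comp_eq_of_forall_mem_range hv.injective (c • LinearMap.id) h
  have hg' : ∀ m, v (g m) = c • m := LinearMap.congr_fun hg
  have hc' : algebraMap R (FractionRing R) c ≠ 0 := by simpa using hc
  have hgv : ∀ x, g (v x) = c * x := fun x => hv.injective (by rw [hg', ← smul_eq_mul, map_smul])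
  refine ⟨(algebraMap R (FractionRing R) c)⁻¹ • (Algebra.linearMap R (FractionRing R) ∘ₗ g), ?_,
    fun x => ?_⟩
  · intro m m' hmm
    simp only [LinearMap.smul_apply, LinearMap.comp_apply, Algebra.linearMap_apply] at hmm
    have h1 := smul_right_injective (FractionRing R) (inv_ne_zero hc') hmm
    have h2 := congr_arg v (IsFractionRing.injective R (FractionRing R) h1)
    rw [hg', hg'] at h2
    exact smul_right_injective M hc h2
  · simp [hgv, hc']

variable {K : Type u} [Field K] [Algebra R K] [IsFractionRing R K]

/-- Fractional ideals are comparable at height one primes of a normal domain. -/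
theorem forall_exists_smul_mem_or [IsNoetherianRing R] [IsIntegrallyClosed R] (p : HeightOne R)
    (I J : Submodule R K) :
    (∀ x ∈ I, ∃ t ∉ p.1, t • x ∈ J) ∨ (∀ y ∈ J, ∃ t ∉ p.1, t • y ∈ I) := by
  have := isDiscreteValuationRing_atPrime p.1 p.2.2
  have hone : (1 : R) ∉ p.1 := fun h => p.2.1.ne_top ((Ideal.eq_top_iff_one _).mpr h)
  -- If x/y = α/β and β divides α in R_p, then x lies in J up to a factor outside p. In the discrete
  -- valuation ring R_p one of α, β divides the other.
  have key : ∀ (I J : Submodule R K) (α β : R) (x y : K), β ≠ 0 → algebraMap R K β * x =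
      algebraMap R K α * y → y ∈ J → algebraMap R (Localization.AtPrime p.1) β ∣ algebraMap R _ α →
      ∃ t ∉ p.1, t • x ∈ J := by
    rintro I J α β x y hβ hxy hy ⟨z, hz⟩
    obtain ⟨γ, s, rfl⟩ := IsLocalization.exists_mk'_eq p.1.primeCompl z
    refine ⟨s, s.2, ?_⟩
    rw [IsLocalization.mul_mk'_eq_mk'_of_mul, eq_comm, IsLocalization.mk'_eq_iff_eq_mul,
      ← map_mul] at hz
    have hz' := IsLocalization.injective (Localization.AtPrime p.1)
      p.1.primeCompl_le_nonZeroDivisors hz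
    have hβ' : algebraMap R K β ≠ 0 := by simpa using hβ
    have h1 : (s : R) • x = γ • y := by
      apply mul_left_cancel₀ hβ'
      rw [Algebra.smul_def, Algebra.smul_def, mul_left_comm, hxy, ← mul_assoc, ← mul_assoc,
        ← map_mul, ← map_mul, hz', mul_comm α]
    rw [h1]
    exact J.smul_mem _ hy
  by_contra! hcon
  obtain ⟨⟨x, hx, hxJ⟩, y, hy, hyI⟩ := hcon
  have hx0 : x ≠ 0 := by
    rintro rfl
    exact hxJ 1 hone (by simp)
  have hy0 : y ≠ 0 := by
    rintro rfl
    exact hyI 1 hone (by simp)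
  obtain ⟨α, β, hβ, hαβ⟩ := IsFractionRing.div_surjective (A := R) (x / y)
  have hβ0 : β ≠ 0 := nonZeroDivisors.ne_zero hβ
  have hβ' : algebraMap R K β ≠ 0 := by simpa using hβ0
  have hxy : algebraMap R K β * x = algebraMap R K α * y := by
    rw [div_eq_div_iff hβ' hy0] at hαβ
    rw [hαβ, mul_comm]
  have hα0 : α ≠ 0 := by
    rintro rfl
    simp [hβ', hx0] at hxy
  rcases ValuationRing.dvd_total (algebraMap R (Localization.AtPrime p.1) β) (algebraMap R _ α)
    with h | h
  · obtain ⟨t, ht, htx⟩ := key I J α β x y hβ0 hxy hy h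
    exact hxJ t ht htx
  · obtain ⟨t, ht, htx⟩ := key J I β α y x hα0 hxy.symm hx h
    exact hyI t ht htx

/-- The images of M and N in K are nested at p, and equal finite colength over the common copy of R
forces them to agree there. -/
theorem exists_smul_mem_range_of_lengthAt_eq [IsNoetherianRing R] [IsIntegrallyClosed R]
    [Module.Finite R M] {v : R →ₗ[R] M} {w : R →ₗ[R] N} (hv : IsLattice v)
    {f : M →ₗ[R] K} {g : N →ₗ[R] K} (hf : Function.Injective f) (hg : Function.Injective g)
    (hfg : ∀ x, f (v x) = g (w x)) {p : HeightOne R}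
    (h : lengthAt p.1 (M ⧸ LinearMap.range v) = lengthAt p.1 (N ⧸ LinearMap.range w)) (m : M) :
    ∃ t ∉ p.1, t • f m ∈ LinearMap.range g := by
  rcases forall_exists_smul_mem_or p (LinearMap.range f) (LinearMap.range g) with hcase | hcase
  · exact hcase _ ⟨m, rfl⟩
  let L : Submodule R K := LinearMap.range f ⊔ LinearMap.range g
  let f' : M →ₗ[R] L := f.codRestrict L fun m => (le_sup_left : _ ≤ L) ⟨m, rfl⟩
  let g' : N →ₗ[R] L := g.codRestrict L fun m => (le_sup_right : _ ≤ L) ⟨m, rfl⟩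
  have hf' : Function.Injective f' := fun a b hab => hf (congr_arg Subtype.val hab)
  have hg' : Function.Injective g' := fun a b hab => hg (congr_arg Subtype.val hab)
  have hcomp : f' ∘ₗ v = g' ∘ₗ w := LinearMap.ext fun x => Subtype.ext (hfg x)
  -- The colength of R in L is computed through M and through N; the finite common summand cancels.
  have hlen : lengthAt p.1 (L ⧸ LinearMap.range f') = lengthAt p.1 (L ⧸ LinearMap.range g') := by
    have h1 := lengthAt_quotient_range_comp p.1 v hf'
    rw [hcomp, lengthAt_quotient_range_comp p.1 w hg', ← h] at h1
    exact (WithTop.add_left_cancel (hv.lengthAt_ne_top p) h1).symm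
  have hzero : lengthAt p.1 (L ⧸ LinearMap.range f') = 0 := by
    rw [lengthAt_eq_zero_iff]
    intro x
    obtain ⟨⟨x, hx⟩, rfl⟩ := Submodule.Quotient.mk_surjective _ x
    obtain ⟨_, ⟨a, rfl⟩, y, hy, rfl⟩ := Submodule.mem_sup.mp hx
    obtain ⟨t, ht, b, hb⟩ := hcase y hy
    refine ⟨t, ht, ?_⟩
    rw [← Submodule.Quotient.mk_smul, Submodule.Quotient.mk_eq_zero]
    refine ⟨t • a + b, Subtype.ext ?_⟩
    change f (t • a + b) = t • (f a + y)
    rw [map_add, map_smul, hb, smul_add]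
  rw [hlen, lengthAt_eq_zero_iff] at hzero
  obtain ⟨t, ht, h0⟩ := hzero (Submodule.Quotient.mk (f' m))
  rw [← Submodule.Quotient.mk_smul, Submodule.Quotient.mk_eq_zero] at h0
  obtain ⟨b, hb⟩ := h0
  exact ⟨t, ht, b, congr_arg Subtype.val hb⟩

/-- Since N is MCM, inclusion may be tested at primes of height at most one: equal colengths handle
height one, and the common copy of R handles the zero ideal. -/
theorem range_le_range_of_lengthAt_eq [IsNoetherianRing R] [IsIntegrallyClosed R]
    [Module.Finite R M] (hN : IsMCM R N) {v : R →ₗ[R] M} {w : R →ₗ[R] N} (hv : IsLattice v)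
    {f : M →ₗ[R] K} {g : N →ₗ[R] K} (hf : Function.Injective f) (hg : Function.Injective g)
    (hfg : ∀ x, f (v x) = g (w x)) (h : ∀ p : HeightOne R,
      lengthAt p.1 (M ⧸ LinearMap.range v) = lengthAt p.1 (N ⧸ LinearMap.range w)) :
    LinearMap.range f ≤ LinearMap.range g := by
  rintro _ ⟨m, rfl⟩
  have : Module.IsTorsionFree R K := inferInstance
  refine mem_range_of_isMCM hN hg fun p hp hp1 => ?_
  by_cases hp' : p.height = 1
  · exact exists_smul_mem_range_of_lengthAt_eq (p := ⟨p, hp, hp'⟩) hv hf hg hfg (h _) m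
  · have hbot : p = ⊥ := by
      rw [← Ideal.height_eq_zero_iff_eq_bot]
      by_contra h0
      exact hp' (le_antisymm hp1 (Order.one_le_iff_ne_zero.mpr h0))
    subst hbot
    obtain ⟨c, hc, h⟩ := hv.exists_smul_mem
    obtain ⟨x, hx⟩ := h m
    exact ⟨c, by simpa using hc, w x, by rw [← hfg, hx, map_smul]⟩

/-- Over a normal domain, maximal Cohen-Macaulay modules of rank one are determined by their class
in `H(R)`. -/
theorem nonempty_linearEquiv_of_H_cls_eq [IsNoetherianRing R] [IsIntegrallyClosed R]
    {M N : FGModuleCat.{u} R} (hM : IsMCM R M) (hN : IsMCM R N) (hM1 : Module.finrank R M = 1)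
    (hN1 : Module.finrank R N = 1) (h : H.cls M = H.cls N) : Nonempty (M ≃ₗ[R] N) := by
  have hdiv : divisorClass R M = divisorClass R N := by
    rw [← divisorClassH_cls, ← divisorClassH_cls, h]
  obtain ⟨v, w, hv, hw, hlen⟩ := exists_isLattice_lengthAt_eq hM1 hN1 hdiv
  have := isTorsionFree_of_isMCM hM
  have := isTorsionFree_of_isMCM hN
  obtain ⟨f, hf, hfv⟩ := hv.exists_injective_fractionRing
  obtain ⟨g, hg, hgw⟩ := hw.exists_injective_fractionRing
  have hfg : ∀ x, f (v x) = g (w x) := fun x => (hfv x).trans (hgw x).symm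
  have hrange : LinearMap.range f = LinearMap.range g := le_antisymm
    (range_le_range_of_lengthAt_eq hN hv hf hg hfg hlen)
    (range_le_range_of_lengthAt_eq hM hw hg hf (fun x => (hfg x).symm) fun p => (hlen p).symm)
  exact ⟨(LinearEquiv.ofInjective f hf).trans ((LinearEquiv.ofEq _ _ hrange).trans
    (LinearEquiv.ofInjective g hg).symm)⟩

end RankOne

/-! ### The class of the canonical dual -/

section Dual

variable {R : Type u} [CommRing R] [IsDomain R]
variable {M N F : Type u} [AddCommGroup M] [Module R M] [AddCommGroup N] [Module R N]
  [AddCommGroup F] [Module R F]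

theorem length_quotient_range_congr {B : Type*} [CommRing B] {F F' M M' : Type*}
    [AddCommGroup F] [Module B F] [AddCommGroup F'] [Module B F'] [AddCommGroup M] [Module B M]
    [AddCommGroup M'] [Module B M'] {f : F →ₗ[B] M} {f' : F' →ₗ[B] M'} (e₁ : F ≃ₗ[B] F')
    (e₂ : M ≃ₗ[B] M') (h : ∀ x, e₂ (f x) = f' (e₁ x)) :
    Module.length B (M ⧸ LinearMap.range f) = Module.length B (M' ⧸ LinearMap.range f') := by
  refine (Submodule.Quotient.equiv _ _ e₂ ?_).length_eq
  ext y
  constructor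
  · rintro ⟨_, ⟨x, rfl⟩, rfl⟩
    exact ⟨e₁ x, (h x).symm⟩
  · rintro ⟨x, rfl⟩
    exact ⟨f (e₁.symm x), ⟨_, rfl⟩, by simpa using h (e₁.symm x)⟩

/-- Over a discrete valuation ring, dualizing a map of free modules preserves the colength. -/
theorem length_quotient_range_lcomp {B : Type*} [CommRing B] [IsDomain B]
    [IsDiscreteValuationRing B] {F M N : Type*} [AddCommGroup F] [Module B F] [Module.Free B F]
    [Module.Finite B F] [AddCommGroup M] [Module B M] [Module.Free B M] [Module.Finite B M]
    [AddCommGroup N] [Module B N] [Module.Free B N] (hN : Module.finrank B N = 1)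
    {v : F →ₗ[B] M} (hv : Function.Injective v)
    (hrank : Module.finrank B F = Module.finrank B M) :
    Module.length B ((F →ₗ[B] N) ⧸ LinearMap.range (LinearMap.lcomp B N v)) =
      Module.length B (M ⧸ LinearMap.range v) := by
  let e : F ≃ₗ[B] M := LinearEquiv.ofFinrankEq F M hrank
  have : Module.Finite B N := Module.finite_of_finrank_eq_succ hN
  let c : N ≃ₗ[B] B := LinearEquiv.ofFinrankEq N B (by simp [hN])
  -- After identifying M with F and N with B, the dual map becomes the transpose of A, which has the
  -- same determinant.
  let A : F →ₗ[B] F := e.symm.toLinearMap ∘ₗ v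
  have hA : LinearMap.det A ≠ 0 := by
    rw [Ne, LinearMap.det_eq_zero_iff_ker_ne_bot, not_not, LinearMap.ker_eq_bot]
    exact e.symm.injective.comp hv
  have h1 : Module.length B (M ⧸ LinearMap.range v) = Module.length B (F ⧸ LinearMap.range A) :=
    length_quotient_range_congr (LinearEquiv.refl B F) e.symm fun _ => rfl
  have h2 : Module.length B ((F →ₗ[B] N) ⧸ LinearMap.range (LinearMap.lcomp B N v)) =
      Module.length B (Module.Dual B F ⧸ LinearMap.range A.dualMap) := by
    refine length_quotient_range_congr (LinearEquiv.arrowCongr e.symm c)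
      (LinearEquiv.arrowCongr (LinearEquiv.refl B F) c) fun f => ?_
    ext x
    simp [A]
  rw [h1, h2, length_quotient_range_eq_ord_det A hA,
    length_quotient_range_eq_ord_det _ (by rwa [LinearMap.det_dualMap]), LinearMap.det_dualMap]

/-- If v ∘ g = c · id, then f ∘ g extends c · f along v. A map on M is determined by its restriction
because N is torsion-free. -/
theorem IsLattice.lcomp [Module.IsTorsionFree R N] {v : F →ₗ[R] M} (hv : IsLattice v) :
    IsLattice (LinearMap.lcomp R N v) := by
  obtain ⟨c, hc, h⟩ := hv.exists_smul_mem
  constructor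
  · intro f g hfg
    ext m
    obtain ⟨x, hx⟩ := h m
    apply smul_right_injective N hc
    simp only
    rw [← map_smul, ← map_smul, ← hx]
    exact LinearMap.congr_fun hfg x
  · obtain ⟨g, hg⟩ := exists_comp_eq_of_forall_mem_range hv.injective (c • LinearMap.id) h
    refine ⟨c, hc, fun f => ⟨f ∘ₗ g, ?_⟩⟩
    ext x
    have : g (v x) = c • x := hv.injective (by
      rw [← LinearMap.comp_apply v, hg, map_smul]
      rfl)
    simp [this]

/-- At a height one prime R_p is a discrete valuation ring, torsion-free modules become free and Hom
commutes with localization, so the local statement applies. -/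
theorem lengthAt_quotient_range_lcomp [IsNoetherianRing R] [IsIntegrallyClosed R]
    [Module.Finite R M] [Module.IsTorsionFree R M] [Module.Finite R N] [Module.IsTorsionFree R N]
    [Module.Free R F] [Module.Finite R F] (hN : Module.finrank R N = 1)
    {v : F →ₗ[R] M} (hv : IsLattice v) (p : HeightOne R) :
    lengthAt p.1 ((F →ₗ[R] N) ⧸ LinearMap.range (LinearMap.lcomp R N v)) =
      lengthAt p.1 (M ⧸ LinearMap.range v) := by
  have := isDiscreteValuationRing_atPrime p.1 p.2.2
  have hle : p.1.primeCompl ≤ nonZeroDivisors R := p.1.primeCompl_le_nonZeroDivisors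
  let S := p.1.primeCompl
  have hrank (X : Type u) [AddCommGroup X] [Module R X] :
      Module.finrank (Localization.AtPrime p.1) (LocalizedModule S X) = Module.finrank R X := by
    rw [IsLocalization.finrank_eq (Localization.AtPrime p.1) S hle]
    exact IsLocalizedModule.finrank_eq S (LocalizedModule.mkLinearMap S X) hle
  have hfree (X : Type u) [AddCommGroup X] [Module R X] [Module.Finite R X]
      [Module.IsTorsionFree R X] : Module.Free (Localization.AtPrime p.1) (LocalizedModule S X) := by
    have : Module.IsTorsionFree (Localization S) (LocalizedModule S X) := inferInstance
    have : Module.Finite (Localization S) (LocalizedModule S X) := inferInstance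
    infer_instance
  have := hfree M
  have := hfree N
  have := Module.finitePresentation_of_finite R M
  have := Module.finitePresentation_of_finite R F
  let v' := LocalizedModule.map S v
  have hv' : Function.Injective v' := LocalizedModule.map_injective S v hv.injective
  have hcomp (f : M →ₗ[R] N) : LinearMap.lcomp (Localization.AtPrime p.1) (LocalizedModule S N) v'
      (LocalizedModule.map S f) = LocalizedModule.map S (LinearMap.lcomp R N v f) := by
    refine LinearMap.ext fun w => ?_
    induction w using LocalizedModule.induction_on with
    | h x t => simp [v', S]
  rw [lengthAt_quotient_range p.1 (LocalizedModule.map S) (LocalizedModule.map S)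
      (f' := LinearMap.lcomp _ _ v') hcomp,
    lengthAt_quotient_range p.1 (LocalizedModule.mkLinearMap S F)
      (LocalizedModule.mkLinearMap S M) (f' := v') (fun x => by simp [v'])]
  exact length_quotient_range_lcomp (by rw [hrank, hN]) hv' (by rw [hrank, hrank, hv.finrank_eq])

/-- `[Hom(M, N)] + [M] = rank(M) ([R] + [N])` in `H(R)` for a rank one module `N` over a normal
domain. -/
theorem H_cls_linearMap_add [IsNoetherianRing R] [IsIntegrallyClosed R]
    [Module.Finite R M] [Module.IsTorsionFree R M] [Module.Finite R N] [Module.IsTorsionFree R N]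
    (hN : Module.finrank R N = 1) :
    H.cls (FGModuleCat.of R (M →ₗ[R] N)) + H.cls (FGModuleCat.of R M) =
      Module.finrank R M • (H.cls (FGModuleCat.of R R) + H.cls (FGModuleCat.of R N)) := by
  -- With F = R^rank(M) inside M and cokernel T, [M] = rank(M)[R] + [T]. Dually Hom(M, N) sits in
  -- N^rank(M) with a cokernel of the same class [T], which cancels in the sum.
  obtain ⟨v, hv⟩ := exists_isLattice R M
  have hv' := hv.lcomp (N := N)
  have h1 := H.cls_eq_add_of_exact (M₁ := FGModuleCat.of R (Fin (Module.finrank R M) → R))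
    (M₂ := FGModuleCat.of R M) (M₃ := FGModuleCat.of R (M ⧸ LinearMap.range v)) v
    (LinearMap.range v).mkQ hv.injective (LinearMap.exact_map_mkQ_range v)
    (Submodule.mkQ_surjective _)
  have h2 := H.cls_eq_add_of_exact (M₁ := FGModuleCat.of R (M →ₗ[R] N))
    (M₂ := FGModuleCat.of R ((Fin (Module.finrank R M) → R) →ₗ[R] N))
    (M₃ := FGModuleCat.of R (_ ⧸ LinearMap.range (LinearMap.lcomp R N v)))
    (LinearMap.lcomp R N v) (LinearMap.range (LinearMap.lcomp R N v)).mkQ hv'.injective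
    (LinearMap.exact_map_mkQ_range _) (Submodule.mkQ_surjective _)
  have h3 := H.cls_eq_of_lengthAt_eq hv'.isBoundedTorsion hv.isBoundedTorsion
    (lengthAt_quotient_range_lcomp hN hv)
  have h4 := H.cls_congr (M := FGModuleCat.of R ((Fin (Module.finrank R M) → R) →ₗ[R] N))
    (N := FGModuleCat.of R (Fin (Module.finrank R M) → N))
    ((Pi.basisFun R (Fin (Module.finrank R M))).constr R).symm
  rw [H.cls_pi] at h1
  rw [h4, h3, H.cls_pi] at h2
  rw [h1, nsmul_add, h2]
  abel

end Dual


/-! ### Cones spanned by points of an affine hyperplane -/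

section Cone

variable {V : Type*} [AddCommGroup V] [Module ℝ V] {ρ : V →ₗ[ℝ] ℝ} {s : Set V}

theorem mem_of_mem_convexHull_of_mem_hull {x : V} (hx : x ∈ convexHull ℝ s) :
    x ∈ PointedCone.hull ℝ s :=
  convexHull_min PointedCone.subset_hull (PointedCone.hull ℝ s).convex hx

/-- The normalization of x + y is the convex combination of the normalizations of x and y with
weights proportional to ρ x and ρ y. -/
theorem eq_zero_or_inv_smul_mem_convexHull (hs : ∀ x ∈ s, ρ x = 1) {x : V}
    (hx : x ∈ PointedCone.hull ℝ s) : x = 0 ∨ 0 < ρ x ∧ (ρ x)⁻¹ • x ∈ convexHull ℝ s := by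
  induction hx using Submodule.span_induction with
  | mem x hx =>
    rw [hs x hx]
    exact Or.inr ⟨one_pos, by simpa using subset_convexHull ℝ s hx⟩
  | zero => exact Or.inl rfl
  | add x y _ _ hx hy =>
    rcases hx with rfl | ⟨hx, hx'⟩
    · simpa using hy
    rcases hy with rfl | ⟨hy, hy'⟩
    · simpa using Or.inr ⟨hx, hx'⟩
    refine Or.inr ⟨by rw [map_add]; positivity, ?_⟩
    have hxy : 0 < ρ x + ρ y := by positivity
    have := convex_convexHull ℝ s hx' hy' (a := ρ x / (ρ x + ρ y)) (b := ρ y / (ρ x + ρ y))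
      (by positivity) (by positivity) (by field_simp)
    convert this using 1
    rw [map_add, smul_smul, smul_smul, smul_add]
    congr 2 <;> field_simp
  | smul a x _ hx =>
    obtain ⟨a, ha⟩ := a
    change a • x = 0 ∨ 0 < ρ (a • x) ∧ (ρ (a • x))⁻¹ • a • x ∈ convexHull ℝ s
    rcases ha.eq_or_lt with rfl | ha
    · simp
    rcases hx with rfl | ⟨hx, hx'⟩
    · simp
    refine Or.inr ⟨by simpa using mul_pos ha hx, ?_⟩
    convert hx' using 1
    rw [map_smul, smul_smul, smul_eq_mul]
    congr 1
    field_simp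

theorem eq_zero_or_inv_smul_mem_hull (hs : ∀ x ∈ s, ρ x = 1) {x : V}
    (hx : x ∈ PointedCone.hull ℝ s) :
    x = 0 ∨ 0 < ρ x ∧ (ρ x)⁻¹ • x ∈ PointedCone.hull ℝ s :=
  (eq_zero_or_inv_smul_mem_convexHull hs hx).imp_right fun h =>
    ⟨h.1, mem_of_mem_convexHull_of_mem_hull h.2⟩

theorem eq_zero_of_mem_hull (hs : ∀ x ∈ s, ρ x = 1) {x : V}
    (hx : x ∈ PointedCone.hull ℝ s) (h : ρ x = 0) : x = 0 :=
  (eq_zero_or_inv_smul_mem_hull hs hx).resolve_right fun h' => h'.1.ne' h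

theorem nonneg_of_mem_hull (hs : ∀ x ∈ s, ρ x = 1) {x : V}
    (hx : x ∈ PointedCone.hull ℝ s) : 0 ≤ ρ x := by
  rcases eq_zero_or_inv_smul_mem_hull hs hx with rfl | h
  · simp
  · exact h.1.le

/-- Arbitrary finite generators can be moved to the hyperplane ρ = 1: those with ρ = 0 are zero and
are dropped, the others are rescaled by a positive number. -/
theorem exists_finset_hull_eq (hs : ∀ x ∈ s, ρ x = 1) {t : Finset V}
    (h : PointedCone.hull ℝ s = PointedCone.hull ℝ (t : Set V)) :
    ∃ t' : Set V, t'.Finite ∧ (∀ x ∈ t', ρ x = 1) ∧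
      PointedCone.hull ℝ s = PointedCone.hull ℝ t' := by
  have ht : ∀ x ∈ t, x ∈ PointedCone.hull ℝ s := fun x hx => by
    rw [h]
    exact PointedCone.subset_hull hx
  refine ⟨(fun x => (ρ x)⁻¹ • x) '' (t ∩ {x | ρ x ≠ 0}), (t.finite_toSet.inter_of_left _).image _,
    ?_, ?_⟩
  · rintro _ ⟨x, ⟨-, hx⟩, rfl⟩
    simpa using inv_mul_cancel₀ hx
  · rw [h]
    apply le_antisymm
    · refine Submodule.span_le.mpr fun x hx => ?_
      by_cases h0 : ρ x = 0
      · rw [eq_zero_of_mem_hull hs (ht x hx) h0]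
        exact zero_mem _
      · have h1 : (ρ x)⁻¹ • x ∈ PointedCone.hull ℝ
            ((fun x => (ρ x)⁻¹ • x) '' (t ∩ {x | ρ x ≠ 0})) :=
          PointedCone.subset_hull ⟨x, ⟨hx, h0⟩, rfl⟩
        have h2 := PointedCone.smul_mem _ (nonneg_of_mem_hull hs (ht x hx)) h1
        rwa [smul_inv_smul₀ h0] at h2
    · refine Submodule.span_le.mpr ?_
      rintro _ ⟨x, ⟨hx, -⟩, rfl⟩
      exact PointedCone.smul_mem _ (inv_nonneg.mpr (nonneg_of_mem_hull hs (ht x hx)))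
        (PointedCone.subset_hull hx)

end Cone

/-! ### Closed cones and bounded slices in finite dimension -/

section TopologicalCone

variable {V : Type*} [NormedAddCommGroup V] [NormedSpace ℝ V] {ρ : V →ₗ[ℝ] ℝ} {s : Set V}

theorem smul_mem_closure_hull {a : ℝ} (ha : 0 ≤ a) {x : V}
    (hx : x ∈ closure (PointedCone.hull ℝ s : Set V)) :
    a • x ∈ closure (PointedCone.hull ℝ s : Set V) :=
  map_mem_closure (continuous_const_smul a) hx fun _ hy => PointedCone.smul_mem _ ha hy

variable [FiniteDimensional ℝ V]

/-- The convex hull is compact, and the cone is the projection of the closed set of pairs (x, k)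
with x = ρ(x)k and ρ(x) ≥ 0 along this compact factor. Adding {0} matters only for empty s. -/
theorem isClosed_hull_of_finite (hs : ∀ x ∈ s, ρ x = 1) (hfin : s.Finite) :
    IsClosed (PointedCone.hull ℝ s : Set V) := by
  have hρ : Continuous ρ := ρ.continuous_of_finiteDimensional
  have hK : IsCompact (convexHull ℝ s) := hfin.isCompact_convexHull ℝ
  have : CompactSpace (convexHull ℝ s) := isCompact_iff_compactSpace.mp hK
  let Z : Set (V × convexHull ℝ s) := {z | 0 ≤ ρ z.1 ∧ z.1 = ρ z.1 • (z.2 : V)}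
  have hZ : IsClosed Z := by
    have h1 : Continuous fun z : V × convexHull ℝ s => ρ z.1 := hρ.comp continuous_fst
    exact (isClosed_le continuous_const h1).inter
      (isClosed_eq continuous_fst (h1.smul (continuous_subtype_val.comp continuous_snd)))
  have h : (PointedCone.hull ℝ s : Set V) = {0} ∪ Prod.fst '' Z := by
    ext x
    constructor
    · intro hx
      rcases eq_zero_or_inv_smul_mem_convexHull hs hx with h | ⟨h, h'⟩
      · exact Or.inl h
      · exact Or.inr ⟨(x, ⟨_, h'⟩), ⟨h.le, (smul_inv_smul₀ h.ne' x).symm⟩, rfl⟩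
    · rintro (rfl | ⟨⟨x, k⟩, ⟨h0, h⟩, rfl⟩)
      · exact zero_mem _
      · simp only at h0 h ⊢
        rw [h]
        exact PointedCone.smul_mem _ h0 (mem_of_mem_convexHull_of_mem_hull k.2)
  rw [h]
  exact isClosed_singleton.union (isClosedMap_fst_of_compactSpace _ hZ)

theorem nonneg_of_mem_closure_hull (hs : ∀ x ∈ s, ρ x = 1) {x : V}
    (hx : x ∈ closure (PointedCone.hull ℝ s : Set V)) : 0 ≤ ρ x :=
  closure_minimal (fun _ h => nonneg_of_mem_hull hs h)
    (isClosed_le continuous_const ρ.continuous_of_finiteDimensional) hx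

/-- On the compact set of unit vectors in the closed cone ρ is positive, so it has a positive
minimum, whose inverse bounds the slice. -/
theorem isBounded_slice (hs : ∀ x ∈ s, ρ x = 1)
    (h : ∀ x ∈ closure (PointedCone.hull ℝ s : Set V), ρ x = 0 → x = 0) :
    Bornology.IsBounded {x | x ∈ PointedCone.hull ℝ s ∧ ρ x = 1} := by
  have hρ : Continuous ρ := ρ.continuous_of_finiteDimensional
  have : ProperSpace V := FiniteDimensional.proper ℝ V
  let T := Metric.sphere (0 : V) 1 ∩ closure (PointedCone.hull ℝ s : Set V)
  have hT : IsCompact T := (isCompact_sphere _ _).inter_right isClosed_closure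
  rw [isBounded_iff_forall_norm_le]
  have hmem : ∀ x ∈ {x | x ∈ PointedCone.hull ℝ s ∧ ρ x = 1}, x ≠ 0 ∧ ‖x‖⁻¹ • x ∈ T := by
    rintro x ⟨hx, hx1⟩
    have h0 : x ≠ 0 := by
      rintro rfl
      simp at hx1
    refine ⟨h0, ?_, smul_mem_closure_hull (by positivity) (subset_closure hx)⟩
    simp [norm_smul, h0]
  rcases T.eq_empty_or_nonempty with hemp | hne
  · exact ⟨0, fun x hx => by simpa [hemp] using (hmem x hx).2⟩
  · obtain ⟨y, hy, hmin⟩ := hT.exists_isMinOn hne hρ.continuousOn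
    have hy0 : 0 < ρ y := by
      refine (nonneg_of_mem_closure_hull hs hy.2).lt_of_ne' fun h0 => ?_
      have h1 := hy.1
      simp [h y hy.2 h0] at h1
    refine ⟨(ρ y)⁻¹, fun x hx => ?_⟩
    have h1 : ρ y ≤ ρ (‖x‖⁻¹ • x) := hmin (hmem x hx).2
    rw [map_smul, hx.2, smul_eq_mul, mul_one] at h1
    have hpos := norm_pos_iff.mpr (hmem x hx).1
    exact (le_inv_comm₀ hy0 hpos).mp h1

/-- By homogeneity a bound B on the slice gives ‖y‖ ≤ Bρ(y) on the cone, an inequality that persists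
on the closure. -/
theorem eq_zero_of_isBounded_slice (hs : ∀ x ∈ s, ρ x = 1)
    (h : Bornology.IsBounded {x | x ∈ PointedCone.hull ℝ s ∧ ρ x = 1}) {x : V}
    (hx : x ∈ closure (PointedCone.hull ℝ s : Set V)) (hx0 : ρ x = 0) : x = 0 := by
  obtain ⟨B, hB⟩ := isBounded_iff_forall_norm_le.mp h
  have key : ∀ y ∈ PointedCone.hull ℝ s, ‖y‖ ≤ B * ρ y := by
    intro y hy
    rcases eq_zero_or_inv_smul_mem_hull hs hy with rfl | ⟨h0, h1⟩
    · simp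
    · have h2 := hB _ ⟨h1, by simp [h0.ne']⟩
      rw [norm_smul, Real.norm_of_nonneg (by positivity)] at h2
      rwa [inv_mul_le_iff₀ h0, mul_comm] at h2
  have h1 : ‖x‖ ≤ B * ρ x := closure_minimal key (isClosed_le continuous_norm
    (continuous_const.mul ρ.continuous_of_finiteDimensional)) hx
  simpa [hx0] using h1

/-- The continuous map y ↦ ρ(y)w - y preserves the cone, hence its closure, and is -1 on the kernel
of ρ. -/
theorem neg_mem_closure_hull {w x : V}
    (hw : ∀ y ∈ PointedCone.hull ℝ s, ρ y • w - y ∈ PointedCone.hull ℝ s)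
    (hx : x ∈ closure (PointedCone.hull ℝ s : Set V)) (hx0 : ρ x = 0) :
    -x ∈ closure (PointedCone.hull ℝ s : Set V) := by
  have hρ : Continuous ρ := ρ.continuous_of_finiteDimensional
  have := map_mem_closure (f := fun y => ρ y • w - y) (by fun_prop) hx hw
  simpa [hx0] using this

end TopologicalCone

/-! ### Integral points -/

section Lattice

/-- Only finitely many elements of a finitely generated abelian group have an image in a given
bounded subset of its real extension. -/
theorem finite_setOf_tmul_mem {A : Type*} [AddCommGroup A] [Module.Finite ℤ A]
    {B : Set (ℝ ⊗[ℤ] A)} (hB : ∀ l : ℝ ⊗[ℤ] A →ₗ[ℝ] ℝ, ∃ N : ℝ, ∀ x ∈ B, |l x| ≤ N) :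
    {a : A | (1 : ℝ) ⊗ₜ[ℤ] a ∈ B}.Finite := by
  have : AddGroup.FG A := Module.Finite.iff_addGroup_fg.mp inferInstance
  -- A is ℤ^n times a finite group. The free coordinates extend to real functionals, so `hB`
  -- confines them to a finite box.
  obtain ⟨n, ι, _, p, hp, e, ⟨φ⟩⟩ := AddCommGroup.equiv_free_prod_directSum_zmod A
  have (i : ι) : NeZero (p i ^ e i) := ⟨pow_ne_zero _ (hp i).ne_zero⟩
  have : Finite (DirectSum ι fun i => ZMod (p i ^ e i)) :=
    Finite.of_equiv _ DFinsupp.equivFunOnFintype.symm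
  let c (i : Fin n) : A →+ ℤ :=
    (Finsupp.applyAddHom i).comp ((AddMonoidHom.fst _ _).comp φ.toAddMonoidHom)
  let l (i : Fin n) : ℝ ⊗[ℤ] A →ₗ[ℝ] ℝ :=
    (TensorProduct.AlgebraTensorModule.rid ℤ ℝ ℝ).toLinearMap ∘ₗ
      (c i).toIntLinearMap.baseChange ℝ
  have hl (i : Fin n) (a : A) : l i (1 ⊗ₜ a) = c i a := by simp [l]
  choose N hN using fun i => hB (l i)
  let ψ (a : A) : (Fin n → ℤ) × DirectSum ι fun i => ZMod (p i ^ e i) :=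
    (fun i => c i a, (φ a).2)
  have hψ : Function.Injective ψ := fun a a' h => by
    obtain ⟨h1, h2⟩ := Prod.ext_iff.mp h
    exact φ.injective (Prod.ext (Finsupp.ext (congr_fun h1)) h2)
  have hfin : (Set.Icc (fun i => -⌈N i⌉) (fun i => ⌈N i⌉) ×ˢ
      (Set.univ : Set (DirectSum ι fun i => ZMod (p i ^ e i)))).Finite :=
    (Set.finite_Icc _ _).prod Set.finite_univ
  refine (hfin.preimage hψ.injOn).subset fun a ha => ⟨⟨fun i => ?_, fun i => ?_⟩, trivial⟩
  all_goals
    have h1 := (abs_le.mp (hN i _ ha))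
    rw [hl] at h1
    have h2 := Int.le_ceil (N i)
  · change -⌈N i⌉ ≤ c i a
    have : ((-⌈N i⌉ : ℤ) : ℝ) ≤ c i a := by
      push_cast
      linarith [h1.1]
    exact_mod_cast this
  · change c i a ≤ ⌈N i⌉
    have : ((c i a : ℤ) : ℝ) ≤ ⌈N i⌉ := h1.2.trans h2
    exact_mod_cast this

end Lattice

/-! ### The conditions on maximal Cohen-Macaulay modules of a fixed rank -/

section Conditions

variable {R : Type u} [CommRing R] {r n : ℕ} (b : Module.Basis (Fin n) ℝ (HR R))

/-- The norm inducing `euclideanMetric b`. -/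
abbrev euclideanNorm : NormedAddCommGroup (HR R) :=
  NormedAddCommGroup.induced (HR R) (EuclideanSpace ℝ (Fin n))
    ((WithLp.linearEquiv 2 ℝ (Fin n → ℝ)).symm.toLinearMap ∘ₗ b.equivFun.toLinearMap)
    ((WithLp.toLp_injective 2).comp b.equivFun.injective)

abbrev euclideanNormedSpace : letI := euclideanNorm b; NormedSpace ℝ (HR R) :=
  letI := euclideanNorm b
  NormedSpace.induced ℝ (HR R) (EuclideanSpace ℝ (Fin n))
    ((WithLp.linearEquiv 2 ℝ (Fin n → ℝ)).symm.toLinearMap ∘ₗ b.equivFun.toLinearMap)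

theorem mcmPoints_subset_mcmCone : mcmPoints R r ⊆ mcmCone R r := PointedCone.subset_hull

theorem FinitelyManyMCM.finitelyManyPoints (h : FinitelyManyMCM R r) : FinitelyManyPoints R r := by
  obtain ⟨S, hS, h⟩ := h
  refine (hS.image HR.cls).subset ?_
  rintro _ ⟨⟨M, hM, hMr, rfl⟩, -⟩
  obtain ⟨N, hN, ⟨e⟩⟩ := h M hM hMr
  exact ⟨N, hN, by rw [HR.cls, HR.cls, H.cls_congr e]⟩

theorem FinitelyManyPoints.conePolyhedral (h : FinitelyManyPoints R r) : ConePolyhedral R r := by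
  rw [FinitelyManyPoints, Set.inter_eq_left.mpr mcmPoints_subset_mcmCone] at h
  exact ⟨h.toFinset, by simp [mcmCone]⟩

theorem closureStronglyConvex_iff : ClosureStronglyConvex r b ↔
    ∀ x ∈ coneClosure r b, -x ∈ coneClosure r b → x = 0 := by
  rw [ClosureStronglyConvex, Set.eq_singleton_iff_unique_mem]
  constructor
  · exact fun h x hx hx' => h.2 x ⟨hx, hx'⟩
  · refine fun h => ⟨?_, fun x hx => h x hx.1 hx.2⟩
    have h0 : (0 : HR R) ∈ coneClosure r b := by
      let := euclideanMetric b
      exact subset_closure (zero_mem (mcmCone R r))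
    exact ⟨h0, by rwa [neg_zero]⟩

theorem IsCanonicalModule.isMCM {ω : FGModuleCat.{u} R} (h : IsCanonicalModule R ω) :
    IsMCM R ω := fun p _ => by
  rw [← height_maximalIdeal_atPrime]
  exact (h.2 p).2.1

variable [IsDomain R]

theorem rkR_cls (M : FGModuleCat.{u} R) : rkR R (HR.cls M) = Module.finrank R M := by
  rw [HR.cls, rkR_tmul, rk_cls]
  simp

variable (R r) in
/-- The rank function normalized to be one on the modules of rank `r`. -/
def normalizedRank : HR R →ₗ[ℝ] ℝ := (r : ℝ)⁻¹ • rkR R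

theorem normalizedRank_eq_one (hr : 0 < r) : ∀ x ∈ mcmPoints R r, normalizedRank R r x = 1 := by
  rintro _ ⟨M, -, hM, rfl⟩
  have : (r : ℝ) ≠ 0 := by positivity
  simp [normalizedRank, rkR_cls, hM, this]

theorem mem_KR_iff_normalizedRank (hr : 0 < r) {x : HR R} :
    x ∈ KR R ↔ normalizedRank R r x = 0 := by
  simp [mem_KR_iff, normalizedRank, hr.ne']

theorem normalizedRank_eq_one_iff (hr : 0 < r) {x : HR R} :
    normalizedRank R r x = 1 ↔ rkR R x = r := by
  have : (r : ℝ) ≠ 0 := by positivity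
  rw [normalizedRank, LinearMap.smul_apply, smul_eq_mul, inv_mul_eq_one₀ this, eq_comm]

theorem ConePolyhedral.coneClosed (hr : 0 < r) (h : ConePolyhedral R r) : ConeClosed r b := by
  obtain ⟨s, hs⟩ := h
  obtain ⟨t, hfin, ht, hst⟩ := exists_finset_hull_eq (normalizedRank_eq_one hr) hs
  let := euclideanNorm b
  let := euclideanNormedSpace b
  have : FiniteDimensional ℝ (HR R) := b.finiteDimensional_of_finite
  have := isClosed_hull_of_finite ht hfin
  rw [← hst] at this
  -- The topology of `euclideanNorm b` agrees with that of `euclideanMetric b` by definition.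
  exact this

theorem closureMeetsKTrivially_iff (hr : 0 < r) : ClosureMeetsKTrivially r b ↔
    ∀ x ∈ coneClosure r b, normalizedRank R r x = 0 → x = 0 := by
  rw [ClosureMeetsKTrivially, Set.eq_singleton_iff_unique_mem]
  constructor
  · exact fun h x hx hx0 => h.2 x ⟨hx, (mem_KR_iff_normalizedRank hr).mpr hx0⟩
  · refine fun h => ⟨⟨?_, zero_mem _⟩, fun x hx => h x hx.1 ((mem_KR_iff_normalizedRank hr).mp hx.2)⟩
    let := euclideanMetric b
    exact subset_closure (zero_mem (mcmCone R r))

theorem ConeClosed.closureMeetsKTrivially (hr : 0 < r) (h : ConeClosed r b) :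
    ClosureMeetsKTrivially r b := by
  rw [closureMeetsKTrivially_iff b hr]
  intro x hx
  have h1 : coneClosure r b = mcmCone R r := by
    let := euclideanMetric b
    exact IsClosed.closure_eq h
  rw [h1] at hx
  exact eq_zero_of_mem_hull (normalizedRank_eq_one hr) hx

theorem sliceBounded_iff (hr : 0 < r) : SliceBounded r b ↔
    letI := euclideanNorm b
    Bornology.IsBounded {x | x ∈ PointedCone.hull ℝ (mcmPoints R r) ∧ normalizedRank R r x = 1} := by
  simp only [normalizedRank_eq_one_iff hr]
  exact Iff.rfl

theorem closureMeetsKTrivially_iff_sliceBounded (hr : 0 < r) :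
    ClosureMeetsKTrivially r b ↔ SliceBounded r b := by
  rw [closureMeetsKTrivially_iff b hr, sliceBounded_iff b hr]
  let := euclideanNorm b
  let := euclideanNormedSpace b
  have : FiniteDimensional ℝ (HR R) := b.finiteDimensional_of_finite
  exact ⟨isBounded_slice (normalizedRank_eq_one hr), fun h x =>
    eq_zero_of_isBounded_slice (normalizedRank_eq_one hr) h⟩

theorem SliceBounded.closureStronglyConvex (hr : 0 < r) (h : SliceBounded r b) :
    ClosureStronglyConvex r b := by
  rw [← closureMeetsKTrivially_iff_sliceBounded b hr, closureMeetsKTrivially_iff b hr] at h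
  rw [closureStronglyConvex_iff]
  intro x hx hx'
  refine h x hx ?_
  have key : ∀ y ∈ coneClosure r b, 0 ≤ normalizedRank R r y := by
    let := euclideanNorm b
    let := euclideanNormedSpace b
    have : FiniteDimensional ℝ (HR R) := b.finiteDimensional_of_finite
    exact fun y => nonneg_of_mem_closure_hull (normalizedRank_eq_one hr)
  have h1 := key x hx
  have h2 := key _ hx'
  rw [map_neg] at h2
  linarith

/-- Rank r MCM points are images of elements of H(R) lying in the bounded slice. -/
theorem SliceBounded.finitelyManyPoints (hr : 0 < r) [Module.Finite ℤ (H R)]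
    (h : SliceBounded r b) : FinitelyManyPoints R r := by
  rw [sliceBounded_iff b hr] at h
  have hfin := finite_setOf_tmul_mem (A := H R)
    (B := {x | x ∈ PointedCone.hull ℝ (mcmPoints R r) ∧ normalizedRank R r x = 1}) <| by
    intro l
    let := euclideanNorm b
    let := euclideanNormedSpace b
    have : FiniteDimensional ℝ (HR R) := b.finiteDimensional_of_finite
    obtain ⟨N, hN⟩ := isBounded_iff_forall_norm_le.mp
      (h.image (LinearMap.toContinuousLinearMap l))
    exact ⟨N, fun x hx => hN _ ⟨x, hx, rfl⟩⟩
  refine (hfin.image ((1 : ℝ) ⊗ₜ[ℤ] ·)).subset ?_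
  rintro _ ⟨⟨M, hM, hMr, rfl⟩, hx⟩
  exact ⟨H.cls M, ⟨hx, normalizedRank_eq_one hr _ ⟨M, hM, hMr, rfl⟩⟩, rfl⟩

/-- Finite generation makes the fibres of H(R) → H(R)_ℝ finite, so finitely many points come from
finitely many classes in H(R), each of which determines a rank one MCM module. -/
theorem FinitelyManyPoints.finitelyManyMCM [IsNoetherianRing R] [IsIntegrallyClosed R]
    [Module.Finite ℤ (H R)] (h : FinitelyManyPoints R 1) : FinitelyManyMCM R 1 := by
  rw [FinitelyManyPoints, Set.inter_eq_left.mpr mcmPoints_subset_mcmCone] at h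
  have hfin := finite_setOf_tmul_mem (A := H R) (B := mcmPoints R 1) fun l => by
    obtain ⟨N, hN⟩ := (h.image fun x => |l x|).bddAbove
    exact ⟨N, fun x hx => hN ⟨x, hx, rfl⟩⟩
  let T : Set (H R) := {x | ∃ M : FGModuleCat.{u} R, (IsMCM R M ∧ Module.finrank R M = 1) ∧
    H.cls M = x}
  have hT : T.Finite := hfin.subset <| by
    rintro _ ⟨M, ⟨hM, hM1⟩, rfl⟩
    exact ⟨M, hM, hM1, rfl⟩
  have : Finite T := hT
  choose f hf using fun x : T => x.2
  refine ⟨Set.range f, Set.finite_range f, fun M hM hM1 => ?_⟩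
  let x : T := ⟨H.cls M, M, ⟨hM, hM1⟩, rfl⟩
  exact ⟨f x, ⟨x, rfl⟩,
    nonempty_linearEquiv_of_H_cls_eq hM (hf x).1.1 hM1 (hf x).1.2 (hf x).2.symm⟩

/-- Duality with values in a canonical module acts on the cone. -/
theorem normalizedRank_smul_sub_mem [IsNoetherianRing R] [IsIntegrallyClosed R] (hr : 0 < r)
    (hR : IsMCM R R) {ω : FGModuleCat.{u} R} (hω : IsCanonicalModule R ω) {y : HR R}
    (hy : y ∈ mcmCone R r) :
    normalizedRank R r y • ((r : ℝ) • (HR.cls (FGModuleCat.of R R) + HR.cls ω)) - y ∈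
      mcmCone R r := by
  set w := (r : ℝ) • (HR.cls (FGModuleCat.of R R) + HR.cls ω) with hw
  induction hy using Submodule.span_induction with
  | mem y hy =>
    -- For y = [M] the difference is [Hom(M, ω)], again an MCM point of rank r. The expression is
    -- linear in y, so generators suffice.
    rw [normalizedRank_eq_one hr y hy, one_smul]
    obtain ⟨M, hM, hMr, rfl⟩ := hy
    have := isTorsionFree_of_isMCM hM
    have := isTorsionFree_of_isMCM hω.isMCM
    have hω1 := finrank_of_isCanonicalModule hω
    refine PointedCone.subset_hull ⟨FGModuleCat.of R (M →ₗ[R] ω), isMCM_linearMap hR hM hω, ?_, ?_⟩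
    · exact (finrank_linearMap_of_isDomain).trans (by rw [hMr, hω1, mul_one])
    · have h := congr_arg ((1 : ℝ) ⊗ₜ[ℤ] ·) (H_cls_linearMap_add (M := M) (N := ω) hω1)
      simp only [TensorProduct.tmul_add, TensorProduct.tmul_smul, hMr] at h
      rw [hw, sub_eq_iff_eq_add, eq_comm]
      refine h.trans ?_
      rw [← Nat.cast_smul_eq_nsmul ℝ]
      rfl
  | zero => simp
  | add x y _ _ hx hy =>
    have := add_mem hx hy
    convert this using 1
    rw [map_add, add_smul]
    abel
  | smul a x _ hx =>
    obtain ⟨a, ha⟩ := a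
    have := PointedCone.smul_mem _ ha hx
    convert this using 1
    change normalizedRank R r (a • x) • w - a • x = a • _
    rw [map_smul, smul_sub, smul_eq_mul, mul_smul]

theorem ClosureStronglyConvex.closureMeetsKTrivially [IsNoetherianRing R] [IsIntegrallyClosed R]
    (hr : 0 < r) (hR : IsMCM R R) {ω : FGModuleCat.{u} R} (hω : IsCanonicalModule R ω)
    (h : ClosureStronglyConvex r b) : ClosureMeetsKTrivially r b := by
  rw [closureStronglyConvex_iff] at h
  rw [closureMeetsKTrivially_iff b hr]
  refine fun x hx hx0 => h x hx ?_
  let := euclideanNorm b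
  let := euclideanNormedSpace b
  have : FiniteDimensional ℝ (HR R) := b.finiteDimensional_of_finite
  exact neg_mem_closure_hull (fun _ => normalizedRank_smul_sub_mem hr hR hω) hx hx0

end Conditions

end CMCone

end


/-! ### Assembly of the implications -/

theorem theorem1p3 (R : Type u) [CommRing R] [IsDomain R] [IsNoetherianRing R]
    [FiniteDimensional ℝ (CMCone.HR R)] (r : ℕ) (hr : 0 < r)
    (n : ℕ) (b : Module.Basis (Fin n) ℝ (CMCone.HR R)) :
    ((CMCone.FinitelyManyMCM R r → CMCone.FinitelyManyPoints R r) ∧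
      (CMCone.FinitelyManyPoints R r → CMCone.ConePolyhedral R r) ∧
      (CMCone.ConePolyhedral R r → CMCone.ConeClosed r b) ∧
      (CMCone.ConeClosed r b → CMCone.ClosureMeetsKTrivially r b) ∧
      (CMCone.ClosureMeetsKTrivially r b ↔ CMCone.SliceBounded r b) ∧
      (CMCone.SliceBounded r b → CMCone.ClosureStronglyConvex r b)) ∧
    (Module.Finite ℤ (CMCone.H R) →
      List.TFAE [CMCone.FinitelyManyPoints R r, CMCone.ConePolyhedral R r,
        CMCone.ConeClosed r b, CMCone.ClosureMeetsKTrivially r b, CMCone.SliceBounded r b]) ∧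
    (IsIntegrallyClosed R → Module.Finite ℤ (CMCone.H R) → r = 1 →
      List.TFAE [CMCone.FinitelyManyMCM R r, CMCone.FinitelyManyPoints R r,
        CMCone.ConePolyhedral R r, CMCone.ConeClosed r b,
        CMCone.ClosureMeetsKTrivially r b, CMCone.SliceBounded r b]) ∧
    (IsIntegrallyClosed R → CMCone.IsMCM R R →
      (∃ ω : FGModuleCat.{u} R, CMCone.IsCanonicalModule R ω) →
      (CMCone.ClosureMeetsKTrivially r b ↔ CMCone.ClosureStronglyConvex r b)) := by
  have hbc : CMCone.FinitelyManyPoints R r → CMCone.ConePolyhedral R r := fun h =>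
    h.conePolyhedral
  have hcd : CMCone.ConePolyhedral R r → CMCone.ConeClosed r b := fun h => h.coneClosed b hr
  have hde : CMCone.ConeClosed r b → CMCone.ClosureMeetsKTrivially r b := fun h =>
    h.closureMeetsKTrivially b hr
  have hef := CMCone.closureMeetsKTrivially_iff_sliceBounded b hr
  have hfg : CMCone.SliceBounded r b → CMCone.ClosureStronglyConvex r b := fun h =>
    h.closureStronglyConvex b hr
  refine ⟨⟨fun h => h.finitelyManyPoints, hbc, hcd, hde, hef, hfg⟩, fun _ => ?_,
    fun _ _ hr1 => ?_, fun _ hR hω => ?_⟩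
  · have hfb : CMCone.SliceBounded r b → CMCone.FinitelyManyPoints R r := fun h =>
      h.finitelyManyPoints b hr
    tfae_have 1 → 2 := hbc
    tfae_have 2 → 3 := hcd
    tfae_have 3 → 4 := hde
    tfae_have 4 → 5 := hef.mp
    tfae_have 5 → 1 := hfb
    tfae_finish
  · subst hr1
    have hfb : CMCone.SliceBounded 1 b → CMCone.FinitelyManyPoints R 1 := fun h =>
      h.finitelyManyPoints b hr
    tfae_have 1 → 2 := fun h => h.finitelyManyPoints
    tfae_have 2 → 1 := fun h => h.finitelyManyMCM
    tfae_have 2 → 3 := hbc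
    tfae_have 3 → 4 := hcd
    tfae_have 4 → 5 := hde
    tfae_have 5 → 6 := hef.mp
    tfae_have 6 → 2 := hfb
    tfae_finish
  · obtain ⟨ω, hω⟩ := hω
    exact ⟨fun h => hfg (hef.mp h), fun h => h.closureMeetsKTrivially b hr hR hω⟩
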